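/- Theorem (Contracted Simons formula). Let $\mathbb H^n=\mathbb R^{2n+1}$, $n\ge 1$, with points $(\bar x,\bar y,t)$ and left-invariant frame $$Z_j=X_j=\partial_{x_j}+y_j\partial_t,\qquad Z_{n+j}=Y_j=\partial_{y_j}-x_j\partial_t\quad(1\le j\le n),\qquad T=\partial_t .$$ Let $\langle\cdot,\cdot\rangle$ be the Riemannian metric making this frame orthonormal, $\mathcal H=\mathrm{span}\{Z_1,\dots,Z_{2n}\}$, $J$ the linear map with $J(X_j)=Y_j$, $J(Y_j)=-X_j$, $J(T)=0$, and $\nabla$ the pseudohermitian connection, i.e. the metric connection with $\nabla_XY-\nabla_YX-[X,Y]=2\langle J(X),Y\rangle T$; equivalently, the connection for which the left-invariant frame is parallel. Let $S$ be a smooth immersed hypersurface without boundary in $\mathbb H^n$. A point $p\in S$ is characteristic if $T_pS=\mathcal H_p$. On the non-characteristic part of $S$, where we locally fix a smooth Riemannian unit normal $N$ with horizontal projection $N^{\mathbb H}$, let $$\nu=\frac{N^{\mathbb H}}{|N^{\mathbb H}|},\qquad \alpha=\frac{\langle N,T\rangle}{|N^{\mathbb H}|},\qquad \mathcal HTS=\mathcal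 H\cap TS,\qquad \pi(X)=X-\langle X,\nu\rangle\nu,\qquad \nabla^S_XY=\nabla_XY-\langle\nabla_XY,\nu\rangle\nu ,$$ and, for sections $X,Y$ of $\mathcal HTS$, $$h(X,Y)=\langle\nabla_X\nu,Y\rangle,\qquad \tilde h(X,Y)=\langle\nabla_X\nu+\alpha J'(X),Y\rangle,\qquad \tilde h_J(X,Y)=\tilde h\big(\pi(J(X)),\pi(J(Y))\big),$$ where $J'(J(\nu))=0$ and $J'=J$ on the orthogonal complement of $J(\nu)$ in $\mathcal HTS$. Put $H=\mathrm{trace}\,h$, $\ell=\tilde h(J(\nu),J(\nu))$ and $q=|\tilde h|^2+4J(\nu)\alpha+2(n+1)\alpha^2$. For a local orthonormal frame $E_1,\dots,E_{2n-1}$ of $\mathcal HTS$ put $$\nabla^{\mathcal H,S}f=\sum_i(E_if)E_i,\quad \langle A,B\rangle=\sum_{i,j}A(E_i,E_j)B(E_i,E_j),\quad |A|^2=\langle A,A\rangle,\quad |\nabla^{\mathcal H,S}\tilde h|^2=\sum_{i,j,k}\big((\nabla^S_{E_i}\tilde h)(E_j,E_k)\big)^2,$$ where $(\nabla^S_X\tilde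 h)(Y,Z)=X(\tilde h(Y,Z))-\tilde h(\nabla^S_XY,Z)-\tilde h(Y,\nabla^S_XZ)$. Finally let $$\hat\Delta^{\mathcal H,S}f=\sum_{i=1}^{2n}\nabla^{\mathbb H,S}_i\nabla^{\mathbb H,S}_if+2\alpha\,J(\nu)f,$$ where $\nabla^{\mathbb H,S}_if$ is the derivative of $f$ along the tangent field $\pi(Z_i)=Z_i-\langle Z_i,\nu\rangle\nu$. Assume that $S$ is minimal, i.e. $H=0$ on the non-characteristic part of $S$, and that $$\nabla^{\mathcal H,S}\alpha=(J(\nu)\alpha)\,J(\nu)\qquad(\mathrm{P}2)$$ on the non-characteristic part of $S$. Then $$\begin{aligned}\tfrac12\hat\Delta^{\mathcal H,S}|\tilde h|^2={}&|\nabla^{\mathcal H,S}\tilde h|^2-q|\tilde h|^2+6\alpha^2|\tilde h|^2-6\alpha^2|\nabla_{J(\nu)}\nu|^2+4J(\nu)\alpha\,|\tilde h|^2-4J(\nu)\alpha\,\ell^2\\&-\big(4J(\nu)\alpha+6\alpha^2\big)\langle\tilde h,\tilde h_J\rangle\end{aligned}$$ on the non-characteristic part of $S$. -/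

import Mathlib

open scoped Manifold ContDiff

namespace Heisenberg

/-! ### The Heisenberg group -/

/-- Coefficients `(a₁,…,aₙ,aₙ₊₁,…,a₂ₙ)` of horizontal vectors with respect to
`X₁,…,Xₙ,Y₁,…,Yₙ`; the index `Sum.inl j` belongs to `Xⱼ`, the index `Sum.inr j` to `Yⱼ`.
The Euclidean inner product is the one that makes `X₁,…,Xₙ,Y₁,…,Yₙ` orthonormal. -/
abbrev Hor (n : ℕ) : Type := EuclideanSpace ℝ (Fin n ⊕ Fin n)

/-- The Heisenberg group as a manifold: `ℝ²ⁿ⁺¹` with points `(z, t)`, `z = (x̄, ȳ)`, where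
`z (Sum.inl j) = xⱼ` and `z (Sum.inr j) = yⱼ`. -/
abbrev Heis (n : ℕ) : Type := Hor n × ℝ

variable {n : ℕ}

/-- The value at `p` of the vector field `∑ⱼ aⱼ Xⱼ + ∑ⱼ aₙ₊ⱼ Yⱼ + s T` with `c = (a, s)`, where
`Xⱼ = ∂/∂xⱼ + yⱼ ∂/∂t`, `Yⱼ = ∂/∂yⱼ - xⱼ ∂/∂t`, `T = ∂/∂t`. -/
def frameVec (p : Heis n) (c : Heis n) : Heis n :=
  (c.1, c.2 + ∑ j : Fin n, (c.1 (Sum.inl j) * p.1 (Sum.inr j) - c.1 (Sum.inr j) * p.1 (Sum.inl j)))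

/-- The coefficients of the tangent vector `w` at `p` with respect to the left-invariant frame
`X₁,…,Xₙ,Y₁,…,Yₙ,T`. -/
def frameCoeff (p : Heis n) (w : Heis n) : Heis n :=
  (w.1, w.2 - ∑ j : Fin n, (w.1 (Sum.inl j) * p.1 (Sum.inr j) - w.1 (Sum.inr j) * p.1 (Sum.inl j)))

theorem frameVec_frameCoeff (p w : Heis n) : frameVec p (frameCoeff p w) = w := by
  ext <;> simp [frameVec, frameCoeff]

theorem frameCoeff_frameVec (p c : Heis n) : frameCoeff p (frameVec p c) = c := by
  ext <;> simp [frameVec, frameCoeff]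

/-- The Riemannian metric that makes `X₁,…,Xₙ,Y₁,…,Yₙ,T` orthonormal, for two vectors given by
their coefficients with respect to this frame. -/
noncomputable def metric (c d : Heis n) : ℝ := inner ℝ c.1 d.1 + c.2 * d.2

/-- The horizontal subspace at `p`, spanned by `X₁,…,Xₙ,Y₁,…,Yₙ`. -/
def horizontalSpace (p : Heis n) : Set (Heis n) := {w | (frameCoeff p w).2 = 0}

/-- The complex structure on horizontal vectors: `J(Xⱼ) = Yⱼ`, `J(Yⱼ) = -Xⱼ`. -/
noncomputable def J (a : Hor n) : Hor n :=
  WithLp.toLp 2 (Sum.elim (fun j => -a (Sum.inr j)) (fun j => a (Sum.inl j)))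

/-! ### Immersed hypersurfaces -/

variable {M : Type*} [TopologicalSpace M] [ChartedSpace (EuclideanSpace ℝ (Fin (2 * n))) M]

/-- The differential of `F` at `p`. -/
noncomputable def tangentMap (F : M → Heis n) (p : M) :
    TangentSpace (𝓡 (2 * n)) p →L[ℝ] Heis n :=
  mfderiv (𝓡 (2 * n)) 𝓘(ℝ, Heis n) F p

/-- `F` is a smooth immersion of the `2n`-dimensional manifold `M` without boundary, that is, a
smooth immersed hypersurface. -/
structure IsImmersedHypersurface (F : M → Heis n) : Prop where
  smooth : ContMDiff (𝓡 (2 * n)) 𝓘(ℝ, Heis n) ∞ F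
  injective : ∀ p : M, Function.Injective (tangentMap F p)

/-- A point is characteristic if the tangent space there is the horizontal subspace. -/
def IsCharacteristic (F : M → Heis n) (p : M) : Prop :=
  Set.range (tangentMap F p) = horizontalSpace (F p)

/-- `N` (given by its coefficients with respect to the left-invariant frame) is a smooth
Riemannian unit normal of the hypersurface on `U`. -/
structure IsUnitNormalOn (F : M → Heis n) (U : Set M) (N : M → Heis n) : Prop where
  smooth : ContMDiffOn (𝓡 (2 * n)) 𝓘(ℝ, Heis n) ∞ N U
  unit : ∀ p ∈ U, metric (N p) (N p) = 1
  normal : ∀ p ∈ U, ∀ v : TangentSpace (𝓡 (2 * n)) p,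
    metric (N p) (frameCoeff (F p) (tangentMap F p v)) = 0

/-- The horizontal unit normal `ν = Nᴴ / |Nᴴ|`, meaningful at non-characteristic points. -/
noncomputable def nu (N : M → Heis n) (p : M) : Hor n := ‖(N p).1‖⁻¹ • (N p).1

/-- The fundamental function `α = ⟨N, T⟩ / |Nᴴ|`, meaningful at non-characteristic points. -/
noncomputable def alpha (N : M → Heis n) (p : M) : ℝ := (N p).2 / ‖(N p).1‖

/-- The vector field `J(ν)`. -/
noncomputable def Jnu (N : M → Heis n) (p : M) : Hor n := J (nu N p)

/-! ### Horizontal tangent vector fields and the connections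

A horizontal vector field along the hypersurface is a map `X : M → Hor n`, namely
`∑ⱼ Xʲ Zⱼ` with `Z₁,…,Z₂ₙ = X₁,…,Xₙ,Y₁,…,Yₙ`. It is tangent iff `⟨X, ν⟩ = 0`. -/

open Classical in
/-- The vector in the tangent space of `M` at `p` whose image under the differential of `F` is the
horizontal vector `∑ⱼ aⱼ Zⱼ`; it exists, and is unique, if the latter is tangent to the
hypersurface (otherwise the value is the irrelevant `0`). -/
noncomputable def lift (F : M → Heis n) (p : M) (a : Hor n) : TangentSpace (𝓡 (2 * n)) p :=
  if h : ∃ v : TangentSpace (𝓡 (2 * n)) p, tangentMap F p v = frameVec (F p) (a, 0)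
  then h.choose else 0

/-- The derivative `X f` of a function `f` on the hypersurface along a horizontal tangent vector
field `X`. When `f` is a horizontal vector field given by its coefficients in the left-invariant
frame, this is `∇_X f` for the pseudohermitian connection `∇`, which is the connection for which
this frame is parallel. -/
noncomputable def der {W : Type*} [NormedAddCommGroup W] [NormedSpace ℝ W]
    (F : M → Heis n) (X : M → Hor n) (f : M → W) (p : M) : W :=
  mfderiv (𝓡 (2 * n)) 𝓘(ℝ, W) f p (lift F p (X p))

/-- The projection `π(X) = X - ⟨X, ν⟩ ν` of horizontal vector fields onto the horizontal tangent
ones. -/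
noncomputable def proj (N : M → Heis n) (X : M → Hor n) (p : M) : Hor n :=
  X p - inner ℝ (X p) (nu N p) • nu N p

/-- The tangent pseudohermitian connection `∇ˢ_X Y = ∇_X Y - ⟨∇_X Y, ν⟩ ν`. -/
noncomputable def covS (F : M → Heis n) (N : M → Heis n) (X Y : M → Hor n) : M → Hor n :=
  proj N (der F X Y)

/-! ### Horizontal tensor fields

Horizontal `(2,0)`-tensor fields are regarded as maps on pairs of horizontal tangent vector
fields. -/

/-- `(∇ˢ_X A)(Y, Z) = X(A(Y, Z)) - A(∇ˢ_X Y, Z) - A(Y, ∇ˢ_X Z)`. -/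
noncomputable def covTensor (F : M → Heis n) (N : M → Heis n)
    (A : (M → Hor n) → (M → Hor n) → M → ℝ) (X Y Z : M → Hor n) (p : M) : ℝ :=
  der F X (A Y Z) p - A (covS F N X Y) Z p - A Y (covS F N X Z) p

/-- An orthonormal basis of the horizontal tangent space at the non-characteristic point `p`,
which is the orthogonal complement of `ν` in the horizontal space. -/
noncomputable def basisAt (N : M → Heis n) (p : M) :
    OrthonormalBasis (Fin (Module.finrank ℝ ↥(ℝ ∙ nu N p)ᗮ)) ℝ ↥(ℝ ∙ nu N p)ᗮ :=
  stdOrthonormalBasis ℝ ↥(ℝ ∙ nu N p)ᗮ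

/-- The index set of `basisAt`. -/
abbrev BasisIndex (N : M → Heis n) (p : M) : Type := Fin (Module.finrank ℝ ↥(ℝ ∙ nu N p)ᗮ)

/-- A horizontal tangent vector field whose value at `p` is the `i`-th vector of the orthonormal
basis `basisAt N p` (tensor fields at `p` depend only on this value). -/
noncomputable def frameField (N : M → Heis n) (p : M) (i : BasisIndex N p) : M → Hor n :=
  proj N (fun _ => (basisAt N p i : Hor n))

/-- The inner product of two horizontal `(2,0)`-tensor fields,
`⟨A, B⟩ = ∑ᵢⱼ A(Eᵢ, Eⱼ) B(Eᵢ, Eⱼ)`. -/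
noncomputable def innerTensor (N : M → Heis n) (A B : (M → Hor n) → (M → Hor n) → M → ℝ)
    (p : M) : ℝ :=
  ∑ i : BasisIndex N p, ∑ j : BasisIndex N p,
    A (frameField N p i) (frameField N p j) p * B (frameField N p i) (frameField N p j) p

/-- The squared norm of the horizontal covariant derivative,
`|∇^{H,S} A|² = ∑ᵢⱼₖ ((∇ˢ_{Eᵢ} A)(Eⱼ, Eₖ))²`. -/
noncomputable def normSqCov (F : M → Heis n) (N : M → Heis n)
    (A : (M → Hor n) → (M → Hor n) → M → ℝ) (p : M) : ℝ :=
  ∑ i : BasisIndex N p, ∑ j : BasisIndex N p, ∑ k : BasisIndex N p,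
    covTensor F N A (frameField N p i) (frameField N p j) (frameField N p k) p ^ 2

/-- The horizontal tangential gradient `∇^{H,S} f = ∑ⱼ (Eⱼ f) Eⱼ`. -/
noncomputable def gradHS (F : M → Heis n) (N : M → Heis n) (f : M → ℝ) (p : M) : Hor n :=
  ∑ i : BasisIndex N p, der F (frameField N p i) f p • frameField N p i p

/-! ### Second fundamental forms -/

/-- The horizontal second fundamental form `h(X, Y) = ⟨∇_X ν, Y⟩`. -/
noncomputable def secondForm (F : M → Heis n) (N : M → Heis n) (X Y : M → Hor n) (p : M) : ℝ :=
  inner ℝ (der F X (nu N) p) (Y p)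

/-- `J' = J` on the orthogonal complement of `J(ν)` in the horizontal tangent space, and
`J'(J(ν)) = 0`. -/
noncomputable def Jprime (N : M → Heis n) (X : M → Hor n) (p : M) : Hor n :=
  J (X p - inner ℝ (X p) (Jnu N p) • Jnu N p)

/-- The symmetric horizontal second fundamental form `h̃(X, Y) = ⟨∇_X ν + α J'(X), Y⟩`. -/
noncomputable def symForm (F : M → Heis n) (N : M → Heis n) (X Y : M → Hor n) (p : M) : ℝ :=
  inner ℝ (der F X (nu N) p + alpha N p • Jprime N X p) (Y p)

/-- `h̃_J(X, Y) = h̃(π(J(X)), π(J(Y)))`. -/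
noncomputable def symFormJ (F : M → Heis n) (N : M → Heis n) (X Y : M → Hor n) : M → ℝ :=
  symForm F N (proj N (fun p => J (X p))) (proj N (fun p => J (Y p)))

/-- `|h̃|²`. -/
noncomputable def normSqSymForm (F : M → Heis n) (N : M → Heis n) (p : M) : ℝ :=
  innerTensor N (symForm F N) (symForm F N) p

/-- The horizontal mean curvature `H = trace h`. -/
noncomputable def meanCurvature (F : M → Heis n) (N : M → Heis n) (p : M) : ℝ :=
  ∑ i : BasisIndex N p, secondForm F N (frameField N p i) (frameField N p i) p

/-- `ℓ = h̃(J(ν), J(ν))`. -/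
noncomputable def ell (F : M → Heis n) (N : M → Heis n) (p : M) : ℝ :=
  symForm F N (Jnu N) (Jnu N) p

/-- The stability function `q = |h̃|² + 4 ⟨∇α, J(ν)⟩ + 2(n+1) α²`. -/
noncomputable def stabilityFn (F : M → Heis n) (N : M → Heis n) (p : M) : ℝ :=
  normSqSymForm F N p + 4 * der F (Jnu N) (alpha N) p + 2 * ((n : ℝ) + 1) * alpha N p ^ 2

/-! ### The modified horizontal tangential Laplacian -/

/-- The horizontal tangential derivative `∇^{H,S}_i f = Z_i f - ⟨∇^H f, ν⟩ ν_i`, i.e. the derivative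
of `f` along `π(Z_i) = Z_i - ν_i ν`. -/
noncomputable def derHS (F : M → Heis n) (N : M → Heis n) (i : Fin n ⊕ Fin n) (f : M → ℝ) :
    M → ℝ :=
  der F (proj N (fun _ => EuclideanSpace.single i (1 : ℝ))) f

/-- The modified horizontal tangential Laplacian
`Δ̂^{H,S} f = ∑ᵢ ∇^{H,S}_i ∇^{H,S}_i f + 2 α ⟨∇^H f, J(ν)⟩`. -/
noncomputable def modLaplacian (F : M → Heis n) (N : M → Heis n) (f : M → ℝ) (p : M) : ℝ :=
  (∑ i : Fin n ⊕ Fin n, derHS F N i (derHS F N i f) p) + 2 * alpha N p * der F (Jnu N) f p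

/-! ### Assumptions on the hypersurface

Both are independent of the choice of the (local) unit normal; since a hypersurface need not be
two-sided, they are required for every unit normal on every open piece. -/

/-- The hypersurface is minimal: `H = 0` on the non-characteristic part. -/
def IsMinimal (F : M → Heis n) : Prop :=
  ∀ (U : Set M) (N : M → Heis n), IsOpen U → IsUnitNormalOn F U N →
    ∀ p ∈ U, ¬ IsCharacteristic F p → meanCurvature F N p = 0

/-- `∇^{H,S} α = ⟨∇α, J(ν)⟩ J(ν)` on the non-characteristic part. -/
def SatisfiesP2 (F : M → Heis n) : Prop :=
  ∀ (U : Set M) (N : M → Heis n), IsOpen U → IsUnitNormalOn F U N →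
    ∀ p ∈ U, ¬ IsCharacteristic F p →
      gradHS F N (alpha N) p = der F (Jnu N) (alpha N) p • Jnu N p

/-- The pseudohermitian connection on the Heisenberg group itself, on vector fields given by their
coefficients with respect to the left-invariant frame, is determined by being metric and by its
torsion `∇_X Y - ∇_Y X - [X, Y] = 2 ⟨J(X), Y⟩ T`. This checks that the connection for which the
frame is parallel has this torsion (that it is metric is the product rule). -/
theorem torsion_eq (X Y : Heis n → Heis n) (p : Heis n)
    (hX : DifferentiableAt ℝ X p) (hY : DifferentiableAt ℝ Y p) :
    frameVec p (fderiv ℝ Y p (frameVec p (X p))) - frameVec p (fderiv ℝ X p (frameVec p (Y p)))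
      - VectorField.lieBracket ℝ (fun r => frameVec r (X r)) (fun r => frameVec r (Y r)) p
      = (0, 2 * inner ℝ (J (X p).1) (Y p).1) := by
  have key : ∀ Z : Heis n → Heis n, DifferentiableAt ℝ Z p → ∀ v : Heis n,
      fderiv ℝ (fun r => frameVec r (Z r)) p v = frameVec p (fderiv ℝ Z p v) +
        (0, ∑ j : Fin n, ((Z p).1 (Sum.inl j) * v.1 (Sum.inr j)
          - (Z p).1 (Sum.inr j) * v.1 (Sum.inl j))) := by
    intro Z hZ v
    have h1 : HasFDerivAt (fun r => (Z r).1)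
        ((ContinuousLinearMap.fst ℝ (Hor n) ℝ).comp (fderiv ℝ Z p)) p :=
      (ContinuousLinearMap.fst ℝ (Hor n) ℝ).hasFDerivAt.comp p hZ.hasFDerivAt
    have h2 : HasFDerivAt (fun r => (Z r).2)
        ((ContinuousLinearMap.snd ℝ (Hor n) ℝ).comp (fderiv ℝ Z p)) p :=
      (ContinuousLinearMap.snd ℝ (Hor n) ℝ).hasFDerivAt.comp p hZ.hasFDerivAt
    have hz : ∀ k : Fin n ⊕ Fin n, HasFDerivAt (fun r => (Z r).1 k)
        ((EuclideanSpace.proj k : Hor n →L[ℝ] ℝ).comp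
          ((ContinuousLinearMap.fst ℝ (Hor n) ℝ).comp (fderiv ℝ Z p))) p := fun k =>
      (EuclideanSpace.proj k : Hor n →L[ℝ] ℝ).hasFDerivAt.comp p h1
    have hr : ∀ k : Fin n ⊕ Fin n, HasFDerivAt (fun r : Heis n => r.1 k)
        ((EuclideanSpace.proj k : Hor n →L[ℝ] ℝ).comp
          (ContinuousLinearMap.fst ℝ (Hor n) ℝ)) p := fun k =>
      ((EuclideanSpace.proj k : Hor n →L[ℝ] ℝ).comp
        (ContinuousLinearMap.fst ℝ (Hor n) ℝ)).hasFDerivAt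
    have h := h1.prodMk (h2.add (HasFDerivAt.fun_sum (u := Finset.univ) fun j _ =>
      ((hz (Sum.inl j)).mul (hr (Sum.inr j))).sub ((hz (Sum.inr j)).mul (hr (Sum.inl j)))))
    have h' : fderiv ℝ (fun r => frameVec r (Z r)) p = _ := h.fderiv
    rw [h']
    refine Prod.ext ?_ ?_
    · simp [frameVec]
    · simp only [frameVec, ContinuousLinearMap.prod_apply, add_apply,
        sum_apply, sub_apply, Prod.snd_add,
        ContinuousLinearMap.comp_apply, smul_apply, smul_eq_mul,
        ContinuousLinearMap.coe_fst', ContinuousLinearMap.coe_snd', PiLp.proj_apply,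
        add_assoc, ← Finset.sum_add_distrib]
      congr 1
      refine Finset.sum_congr rfl fun j _ => ?_
      ring
  rw [VectorField.lieBracket, key X hX, key Y hY]
  refine Prod.ext ?_ ?_
  · simp [frameVec]
  · simp only [frameVec, J, Prod.snd_sub, Prod.snd_add, PiLp.inner_apply, Fintype.sum_sum_type,
      Sum.elim_inl, Sum.elim_inr, RCLike.inner_apply, conj_trivial, mul_add, Finset.mul_sum]
    have e : ∀ a b c d e f g : ℝ, e - f = g → (a + b) - (c + d) - ((a + b + e) - (c + d + f)) = -g := by
      intros; linarith
    rw [e _ _ _ _ _ _ _ rfl, ← Finset.sum_sub_distrib, ← Finset.sum_neg_distrib,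
      ← Finset.sum_add_distrib]
    refine Finset.sum_congr rfl fun j _ => ?_
    ring

end Heisenberg

/-! The argument is the classical Simons computation, carried out with functions in the
left-invariant frame instead of a moving frame. Let `D i` be the derivative along the tangent field
`π(Z_i)` and `T` the derivative along `T - αν`; these fields span the tangent spaces. The geometry
becomes matrices of functions: the shape operator `A k b = D b (ν k)`, the compression `K` of `J` to
the complement of `ν`, and `B = A + αK`, which represents h̃.

All geometric input sits in `StructureEquations`. The frame is parallel and the torsion is known, so
the Lie bracket of two of these fields can be computed. Expanding it in the spanning fields gives
the commutators. The mere fact that it is tangent gives `A - Aᵀ = -2αK`, hence the symmetry of `B`,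
and `Tν = Dα + 2α²J(ν)` (`lieBracket_horField`, `lieBracket_vertField`). Minimality adds `tr A = 0`,
and (P2) adds `Dα = λJ(ν)`.

What remains is algebra in a commutative ring with derivations. The commutator applied to `ν` is the
Codazzi equation, and its trace is the Laplacian of `ν` (`laplacian_ν`). Commuting derivatives once
more gives the Laplacian of `A` (`laplacian_A`). Since the Laplacian of `ν` contains `-2αA(J(ν))`,
this produces `-2α` times the derivative of `A` along `J(ν)`, which is exactly what the first-order
term of the modified Laplacian absorbs. The torsion leaves a derivative of `λ` along `K(B(J(ν)))`.
That vector is orthogonal to `ν` and `J(ν)`, and in such directions the commutator on `α` together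
with (P2) determines the derivative (`D_lam`, `D_mu_KBe`).

On contraction with the symmetric `B`, every term with a factor `ν` disappears
(`contract_laplacian_A`), and so does the Laplacian of the skew matrix `αK`. The normal components
of the derivative of `B` are algebraic because `Bν = 0` (`sum_sq_DB`); their contribution cancels
the quartic traces up to terms in `α²` (`sum_traces`). This yields `simons`.

To return to the hypersurface, smooth functions on the non-characteristic part of a chart form such
a ring (`calculus`). Sums over an orthonormal basis become traces, because the matrix `Q` of basis
vectors satisfies `QᵀQ = P`, the projection orthogonal to `ν`. -/

/-! ### The algebra of horizontal tangential derivatives -/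

open Matrix in
/-- A commutative algebra with derivations `D i` and `T`, playing the role of the horizontal
tangential derivatives and of the derivative along `T - α ν` on a hypersurface with horizontal
unit normal `ν`. -/
structure HorizontalCalculus (ι R : Type*) [Fintype ι] [DecidableEq ι] [CommRing R]
    [Algebra ℝ R] where
  D : ι → Derivation ℝ R R
  T : Derivation ℝ R R
  J : Matrix ι ι R
  ν : ι → R
  α : R
  J_transpose : Jᵀ = -J
  J_mul_J : J * J = -1
  D_J : ∀ i a b, D i (J a b) = 0
  norm_ν : ν ⬝ᵥ ν = 1
  D_ν : ∀ f, ∑ i, ν i * D i f = 0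

namespace HorizontalCalculus

open Matrix

variable {ι R : Type*} [Fintype ι] [DecidableEq ι] [CommRing R] [Algebra ℝ R]
  (H : HorizontalCalculus ι R)

/-- The vector field `J(ν)`. -/
def e : ι → R := H.J *ᵥ H.ν

/-- The compression of `J` to the orthogonal complement of `ν`. -/
def K : Matrix ι ι R := H.J - vecMulVec H.e H.ν + vecMulVec H.ν H.e

/-- The shape operator `a ↦ D_a ν`. -/
def A : Matrix ι ι R := of fun k b => H.D b (H.ν k)

/-- The symmetrized shape operator. -/
def B : Matrix ι ι R := H.A + H.α • H.K

/-- The derivative of `α` along `J(ν)`. -/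
def lam : R := ∑ i, H.e i * H.D i H.α

/-- The squared norm of `B`. -/
def normSqB : R := ∑ k, ∑ b, H.B k b ^ 2

/-- The structure equations of a minimal hypersurface whose function `α` has gradient parallel to
`J(ν)`. -/
structure StructureEquations : Prop where
  comm_D : ∀ a b f, H.D a (H.D b f) - H.D b (H.D a f) =
    ∑ c, (H.ν a * H.A c b - H.ν b * H.A c a) * H.D c f - 2 * H.K b a * H.T f
  comm_T : ∀ a f, H.D a (H.T f) - H.T (H.D a f) =
    ∑ c, (-(H.α * H.A c a) + H.ν a * H.T (H.ν c)) * H.D c f - 2 * H.α * H.e a * H.T f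
  A_sub : ∀ a b, H.A a b - H.A b a = -(2 * H.α * H.K a b)
  T_ν : ∀ c, H.T (H.ν c) = H.D c H.α + 2 * H.α ^ 2 * H.e c
  D_α : ∀ c, H.D c H.α = H.lam * H.e c
  trace_A : H.A.trace = 0

/-! ### Pointwise linear algebra -/

theorem two_cancel {x : R} (h : x = -x) : x = 0 := by
  have h2 : (2 : ℝ) • x = 0 := by
    rw [two_smul]; nth_rewrite 2 [h]; simp
  calc x = ((1 / 2 : ℝ) * 2) • x := by norm_num
    _ = 0 := by rw [mul_smul, h2, smul_zero]

theorem e_vecMul : H.ν ᵥ* H.J = -H.e := by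
  rw [← mulVec_transpose, H.J_transpose, neg_mulVec, e]

theorem J_e : H.J *ᵥ H.e = -H.ν := by
  rw [e, mulVec_mulVec, H.J_mul_J, neg_mulVec, one_mulVec]

theorem e_vecMul_J : H.e ᵥ* H.J = H.ν := by
  rw [← mulVec_transpose, H.J_transpose, neg_mulVec, J_e, neg_neg]

theorem ν_dot_e : H.ν ⬝ᵥ H.e = 0 := by
  refine two_cancel ?_
  nth_rewrite 1 [e]
  rw [dotProduct_mulVec, e_vecMul, neg_dotProduct, dotProduct_comm]

theorem e_dot_ν : H.e ⬝ᵥ H.ν = 0 := by rw [dotProduct_comm, ν_dot_e]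

theorem e_dot_e : H.e ⬝ᵥ H.e = 1 := by
  nth_rewrite 2 [e]
  rw [dotProduct_mulVec, e_vecMul_J, norm_ν]

theorem K_apply (a b : ι) : H.K a b = H.J a b - H.e a * H.ν b + H.ν a * H.e b := by
  simp [K, vecMulVec_apply]

theorem K_ν : H.K *ᵥ H.ν = 0 := by
  simp [K, add_mulVec, sub_mulVec, vecMulVec_mulVec, H.norm_ν, H.e_dot_ν, ← e.eq_1]

theorem K_e : H.K *ᵥ H.e = 0 := by
  simp [K, add_mulVec, sub_mulVec, vecMulVec_mulVec, H.ν_dot_e, H.e_dot_e, H.J_e]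

theorem K_transpose : H.Kᵀ = -H.K := by
  ext a b
  have := congrFun (congrFun H.J_transpose a) b
  simp only [transpose_apply, Matrix.neg_apply, K_apply] at this ⊢
  linear_combination this

theorem K_swap (a b : ι) : H.K a b = -H.K b a := by
  have := congrFun (congrFun H.K_transpose b) a
  simpa using this

theorem ν_vecMul_K : H.ν ᵥ* H.K = 0 := by
  rw [← mulVec_transpose, K_transpose, neg_mulVec, K_ν, neg_zero]

theorem e_vecMul_K : H.e ᵥ* H.K = 0 := by
  rw [← mulVec_transpose, K_transpose, neg_mulVec, K_e, neg_zero]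

theorem J_mul_K : H.J * H.K = -1 + vecMulVec H.ν H.ν + vecMulVec H.e H.e := by
  rw [K, mul_add, mul_sub, H.J_mul_J, mul_vecMulVec, mul_vecMulVec, J_e, ← e.eq_1,
    neg_vecMulVec, sub_neg_eq_add]

/-- `K` vanishes on `ν` and `J(ν)` and agrees with `J` on their common complement, where `J² = -1`.
-/
theorem K_mul_K : H.K * H.K = -1 + vecMulVec H.ν H.ν + vecMulVec H.e H.e := by
  nth_rewrite 1 [K]
  rw [add_mul, sub_mul, J_mul_K, vecMulVec_mul, vecMulVec_mul, ν_vecMul_K, e_vecMul_K]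
  simp

theorem ν_vecMul_A : H.ν ᵥ* H.A = 0 := by
  ext b
  refine two_cancel ?_
  have h := congrArg (H.D b) H.norm_ν
  simp only [dotProduct, map_sum, Derivation.leibniz, smul_eq_mul, Derivation.map_one_eq_zero,
    Finset.sum_add_distrib] at h
  simp only [vecMul, dotProduct, A, of_apply]
  linear_combination h

/-- This is the other side of `ν_vecMul_A`: there `ν` has unit length, here no derivative is taken
in the direction of `ν`. -/
theorem A_ν : H.A *ᵥ H.ν = 0 := by
  ext k
  simp only [mulVec, dotProduct, A, of_apply, Pi.zero_apply]
  rw [← H.D_ν (H.ν k)]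
  exact Finset.sum_congr rfl fun i _ => mul_comm _ _

theorem A_eq : H.A = H.B - H.α • H.K := by simp [B]

theorem B_ν : H.B *ᵥ H.ν = 0 := by
  simp [B, add_mulVec, A_ν, smul_mulVec, K_ν]

theorem ν_vecMul_B : H.ν ᵥ* H.B = 0 := by
  simp [B, vecMul_add, ν_vecMul_A, vecMul_smul, ν_vecMul_K]

theorem A_e : H.A *ᵥ H.e = H.B *ᵥ H.e := by
  simp [B, add_mulVec, smul_mulVec, K_e]

theorem B_transpose (h : H.StructureEquations) : H.Bᵀ = H.B := by
  ext a b
  have h1 := h.A_sub a b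
  have h2 := H.K_swap a b
  simp only [transpose_apply, B, Matrix.add_apply, Matrix.smul_apply, smul_eq_mul]
  linear_combination -h1 + H.α * h2

theorem A_transpose (h : H.StructureEquations) : H.Aᵀ = H.B + H.α • H.K := by
  rw [A_eq, transpose_sub, transpose_smul, K_transpose, B_transpose H h]
  simp

/-- `J` and `K` differ by matrices having `ν` as a left or a right factor, and these are killed by
the outer matrices. -/
theorem mul_J_mul {M N : Matrix ι ι R} (hM : M *ᵥ H.ν = 0) (hN : H.ν ᵥ* N = 0) :
    M * H.J * N = M * H.K * N := by
  simp [K, mul_add, mul_sub, sub_mul, mul_vecMulVec, vecMulVec_mul, hM, hN,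
    Matrix.mul_assoc]

theorem trace_K_mul_K : (H.K * H.K).trace = 2 - Fintype.card ι := by
  simp [K_mul_K, trace_add, trace_neg, H.norm_ν, H.e_dot_e]
  ring

theorem trace_J_mul_K : (H.J * H.K).trace = 2 - Fintype.card ι := by
  rw [J_mul_K, ← K_mul_K, trace_K_mul_K]

omit [DecidableEq ι] in
theorem trace_mul_eq_zero {S : Matrix ι ι R} {N : Matrix ι ι R} (hS : Sᵀ = S) (hN : Nᵀ = -N) :
    (S * N).trace = 0 := by
  refine two_cancel ?_
  nth_rewrite 1 [← trace_transpose]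
  rw [transpose_mul, hS, hN, neg_mul, trace_neg, trace_mul_comm]

/-- The squared norm of `B(J(ν))`. -/
def normSqBe : R := H.B *ᵥ H.e ⬝ᵥ H.B *ᵥ H.e

/-- The function `B(J(ν), J(ν))`. -/
def ell : R := H.e ⬝ᵥ H.B *ᵥ H.e

/-- The inner product of `B` with its conjugate by `J`. -/
def innerBJ : R := -(H.B * H.K * H.B * H.K).trace

theorem normSqB_eq (h : H.StructureEquations) : H.normSqB = (H.B * H.B).trace := by
  nth_rewrite 1 [← H.B_transpose h]
  rw [normSqB, trace, Finset.sum_comm]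
  simp [Matrix.mul_apply, pow_two]

/-- `-K²` is the projection off `ν` and `J(ν)`. The `ν` part is lost because `Bν = 0`, and the
`J(ν)` part leaves `|B(J(ν))|²`. -/
theorem trace_BBKK (h : H.StructureEquations) :
    (H.B * H.B * (H.K * H.K)).trace = H.normSqBe - H.normSqB := by
  rw [K_mul_K, mul_add, mul_add, mul_vecMulVec, mul_vecMulVec, trace_add, trace_add,
    trace_vecMulVec, trace_vecMulVec, ← mulVec_mulVec, ← mulVec_mulVec, H.B_ν, normSqB_eq H h,
    normSqBe]
  have : (H.B *ᵥ (H.B *ᵥ H.e)) ⬝ᵥ H.e = (H.B *ᵥ H.e) ⬝ᵥ (H.B *ᵥ H.e) := by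
    rw [dotProduct_comm, dotProduct_mulVec, ← mulVec_transpose, B_transpose H h]
  rw [this]; simp; ring

theorem trace_BBBK (h : H.StructureEquations) : (H.B * H.B * H.B * H.K).trace = 0 :=
  trace_mul_eq_zero (by simp [B_transpose H h, Matrix.mul_assoc]) H.K_transpose

theorem trace_BK (h : H.StructureEquations) : (H.B * H.K).trace = 0 :=
  trace_mul_eq_zero (B_transpose H h) H.K_transpose

theorem K_cube : H.K * H.K * H.K = -H.K := by
  rw [K_mul_K]
  simp [add_mul, vecMulVec_mul, ν_vecMul_K, e_vecMul_K]

theorem trace_BKKK (h : H.StructureEquations) : (H.B * H.K * H.K * H.K).trace = 0 := by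
  rw [Matrix.mul_assoc, Matrix.mul_assoc, ← Matrix.mul_assoc H.K, K_cube]
  simp [trace_BK H h]

/-! ### First derivatives -/

theorem D_ν_eq (i k : ι) : H.D i (H.ν k) = H.A k i := rfl

theorem D_e (i k : ι) : H.D i (H.e k) = (H.J * H.A) k i := by
  simp only [e, mulVec, dotProduct, map_sum, Derivation.leibniz, smul_eq_mul, H.D_J, mul_zero,
    add_zero, Matrix.mul_apply, D_ν_eq]

theorem D_K (i a b : ι) : H.D i (H.K a b) =
    -((H.J * H.A) a i * H.ν b) - H.e a * H.A b i + H.A a i * H.e b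
      + H.ν a * (H.J * H.A) b i := by
  simp only [K_apply, map_add, map_sub, Derivation.leibniz, smul_eq_mul, H.D_J, D_e, D_ν_eq]
  ring

/-- The coefficient of `J(ν)` in the derivative of `ν` along `T - α ν`. -/
def mu : R := H.lam + 2 * H.α ^ 2

theorem T_ν_eq (h : H.StructureEquations) (c : ι) : H.T (H.ν c) = H.mu * H.e c := by
  rw [h.T_ν, h.D_α, mu]; ring

theorem trace_J_mul_A (h : H.StructureEquations) :
    (H.J * H.A).trace = H.α * (Fintype.card ι - 2) := by
  have h0 : (H.J * H.B).trace = 0 := by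
    rw [trace_mul_comm]; exact trace_mul_eq_zero (B_transpose H h) H.J_transpose
  rw [A_eq, mul_sub, trace_sub, h0, Matrix.mul_smul, trace_smul, trace_J_mul_K, smul_eq_mul]
  ring

theorem trace_A_mul_A (h : H.StructureEquations) :
    (H.A * H.A).trace = H.normSqB - (Fintype.card ι - 2) * H.α ^ 2 := by
  have h1 : (H.K * H.B).trace = 0 := by rw [trace_mul_comm, trace_BK H h]
  rw [A_eq]
  simp only [mul_sub, sub_mul, trace_sub, Matrix.mul_smul, smul_mul, trace_smul, smul_eq_mul,
    trace_BK H h, h1, trace_K_mul_K, ← normSqB_eq H h]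
  ring

theorem sum_mul_e (M : Matrix ι ι R) (k : ι) : ∑ i, M k i * H.e i = (M *ᵥ H.e) k := rfl

theorem sum_mul_ν (M : Matrix ι ι R) (k : ι) : ∑ i, M k i * H.ν i = (M *ᵥ H.ν) k := rfl

/-- The trace of `D_K`: of its four terms one dies by `Aν = 0` and one by `tr A = 0`, and `tr(JA)`
comes only from the skew part of `A`. -/
theorem div_K (h : H.StructureEquations) (k : ι) :
    ∑ i, H.D i (H.K k i) = H.α * (Fintype.card ι - 2) * H.ν k + (H.A *ᵥ H.e) k := by
  have h1 : ∑ i, (H.J * H.A) k i * H.ν i = 0 := by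
    rw [sum_mul_ν, ← mulVec_mulVec, A_ν]; simp
  have h2 : ∑ i, H.A i i = 0 := h.trace_A
  have h3 : ∑ i, (H.J * H.A) i i = H.α * (Fintype.card ι - 2) := H.trace_J_mul_A h
  simp only [D_K, Finset.sum_add_distrib, Finset.sum_sub_distrib, Finset.sum_neg_distrib,
    ← Finset.mul_sum, h1, h2, h3, sum_mul_e]
  ring

/-- The Codazzi equation. -/
theorem codazzi (h : H.StructureEquations) (a b k : ι) :
    H.D a (H.A k b) - H.D b (H.A k a) =
      H.ν a * (H.A * H.A) k b - H.ν b * (H.A * H.A) k a - 2 * H.K b a * (H.mu * H.e k) := by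
  have := h.comm_D a b (H.ν k)
  rw [T_ν_eq H h] at this
  simp only [D_ν_eq] at this
  rw [this]
  congr 1
  simp only [Matrix.mul_apply, Finset.mul_sum, ← Finset.sum_sub_distrib]
  exact Finset.sum_congr rfl fun c _ => by ring

theorem A_swap (h : H.StructureEquations) (k i : ι) :
    H.A k i = H.A i k - 2 * H.α * H.K k i := by
  linear_combination h.A_sub k i

theorem K_e_apply (k : ι) : ∑ i, H.K k i * H.e i = 0 := congrFun H.K_e k

theorem K_ν_apply (k : ι) : ∑ i, H.K k i * H.ν i = 0 := congrFun H.K_ν k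

/-- Exchange the indices of `A k i` at the cost of `-2αK`, then apply Codazzi so that the derivative
falls on `tr A = 0`. The divergence of `αK` accounts for the term `-2αA(J(ν))` and corrects the
coefficient of `ν`. -/
theorem laplacian_ν (h : H.StructureEquations) (k : ι) :
    ∑ i, H.D i (H.A k i) = -((H.normSqB + (Fintype.card ι - 2) * H.α ^ 2) * H.ν k)
      - 2 * H.α * (H.A *ᵥ H.e) k := by
  -- Codazzi is used with the component index equal to the summation index `i`, so that `D k (A i
  -- i)` sums to the derivative of the trace.
  have h1 : ∀ i, H.D i (H.A k i) = H.D k (H.A i i) +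
      (H.ν i * (H.A * H.A) i k - H.ν k * (H.A * H.A) i i - 2 * H.mu * (H.K k i * H.e i))
      - 2 * (H.α * H.D i (H.K k i) + H.lam * (H.K k i * H.e i)) := by
    intro i
    have hc := H.codazzi h i k i
    rw [A_swap H h k i, map_sub, mul_assoc, Derivation.leibniz, Derivation.leibniz,
      h.D_α]
    have h2 : H.D i (2 : R) = 0 := by
      have := (H.D i).map_natCast 2
      simpa using this
    rw [h2]
    simp only [smul_eq_mul]
    linear_combination hc
  have h2 : ∑ i, H.D k (H.A i i) = 0 := by
    rw [← map_sum]
    have : ∑ i, H.A i i = 0 := h.trace_A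
    rw [this, map_zero]
  have h3 : ∑ i, H.ν i * (H.A * H.A) i k = 0 := by
    have : (H.ν ᵥ* (H.A * H.A)) k = 0 := by rw [← vecMul_vecMul, ν_vecMul_A]; simp
    exact this
  have h4 : ∑ i, (H.A * H.A) i i = _ := H.trace_A_mul_A h
  simp only [h1, Finset.sum_add_distrib, Finset.sum_sub_distrib, ← Finset.mul_sum, h2, h3, h4,
    K_e_apply, div_K H h]
  ring

/-! ### Consequences of the assumption on the gradient of `α` -/

/-- Evaluate the commutator of the derivatives along `J(ν)` and `b` on `α` twice. By the structure
equation it vanishes: both directions are orthogonal to `ν`, and the `T` term carries `K(J(ν)) = 0`.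
By (P2) it is the difference of the two sides. No such information is available along `J(ν)` itself.
-/
theorem D_lam (h : H.StructureEquations) {b : ι → R} (hν : b ⬝ᵥ H.ν = 0) (he : b ⬝ᵥ H.e = 0) :
    ∑ i, b i * H.D i H.lam = H.lam * (b ⬝ᵥ (H.J * H.A) *ᵥ H.e) := by
  have h1 : ∀ a c, H.D a (H.D c H.α) - H.D c (H.D a H.α) =
      H.e c * H.D a H.lam + H.lam * (H.J * H.A) c a - H.e a * H.D c H.lam
        - H.lam * (H.J * H.A) a c := by
    intro a c
    simp only [h.D_α, Derivation.leibniz, smul_eq_mul, D_e]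
    ring
  have h2 : ∑ a, ∑ c, H.e a * b c * (H.D a (H.D c H.α) - H.D c (H.D a H.α)) = 0 := by
    have h3 : ∀ a c, H.e a * b c * (H.D a (H.D c H.α) - H.D c (H.D a H.α)) =
      (H.e a * H.ν a) * (∑ d, b c * (H.A d c * H.D d H.α))
        - (b c * H.ν c) * (∑ d, H.e a * (H.A d a * H.D d H.α))
        - 2 * (H.K c a * H.e a) * b c * H.T H.α := by
      intro a c
      rw [h.comm_D, mul_sub]
      congr 1
      · simp only [Finset.mul_sum, ← Finset.sum_sub_distrib]
        exact Finset.sum_congr rfl fun d _ => by ring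
      · ring
    have h4 : ∑ a, H.e a * H.ν a = 0 := H.e_dot_ν
    have h5 : ∑ a, b a * H.ν a = 0 := hν
    simp only [h3, Finset.sum_sub_distrib]
    simp only [← Finset.mul_sum, ← Finset.sum_mul, h4, h5]
    rw [Finset.sum_comm]
    simp only [← Finset.mul_sum, ← Finset.sum_mul, K_e_apply]
    simp
  have h6 : ∑ a, H.e a * H.e a = 1 := H.e_dot_e
  have h7 : ∑ a, b a * H.e a = 0 := he
  have h8 : ∀ c, ∑ a, H.e a * (H.J * H.A) a c = 0 := by
    intro c
    have : (H.e ᵥ* (H.J * H.A)) c = 0 := by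
      rw [← vecMul_vecMul, e_vecMul_J, ν_vecMul_A]; rfl
    exact this
  have h9 : ∀ a c, H.e a * b c * (H.D a (H.D c H.α) - H.D c (H.D a H.α)) =
      (b c * H.e c) * (H.e a * H.D a H.lam) + H.lam * (b c * ((H.J * H.A) c a * H.e a))
      - (H.e a * H.e a) * (b c * H.D c H.lam) - H.lam * b c * (H.e a * (H.J * H.A) a c) := by
    intro a c; rw [h1]; ring
  simp only [h9, Finset.sum_sub_distrib, Finset.sum_add_distrib] at h2
  simp only [← Finset.mul_sum, ← Finset.sum_mul, h6, h7] at h2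
  have h10 : ∑ x, ∑ i, H.lam * b i * (H.e x * (H.J * H.A) x i) = 0 := by
    rw [Finset.sum_comm]
    simp only [← Finset.mul_sum, h8, mul_zero, Finset.sum_const_zero]
  have h11 : ∑ x, ∑ i, b i * ((H.J * H.A) i x * H.e x) = b ⬝ᵥ (H.J * H.A) *ᵥ H.e := by
    rw [Finset.sum_comm]
    simp only [← Finset.mul_sum, sum_mul_e]
    rfl
  rw [h10, h11] at h2
  linear_combination -h2

/-- `Dμ` differs from `Dλ` by a multiple of `J(ν)`, which is invisible to the image of `K`, so
`D_lam` applies. The right side appears because `KᵀJ` is the projection off `ν` and `J(ν)`. -/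
theorem D_mu_KBe (h : H.StructureEquations) :
    (H.K *ᵥ (H.B *ᵥ H.e)) ⬝ᵥ (fun i => H.D i H.mu) = H.lam * (H.normSqBe - H.ell ^ 2) := by
  have hν : (H.K *ᵥ (H.B *ᵥ H.e)) ⬝ᵥ H.ν = 0 := by
    rw [dotProduct_comm, dotProduct_mulVec, ν_vecMul_K, zero_dotProduct]
  have he : (H.K *ᵥ (H.B *ᵥ H.e)) ⬝ᵥ H.e = 0 := by
    rw [dotProduct_comm, dotProduct_mulVec, e_vecMul_K, zero_dotProduct]
  have h1 := H.D_lam h hν he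
  have h2 : ∀ i, H.D i H.mu = H.D i H.lam + 4 * H.α * H.lam * H.e i := by
    intro i
    have h2 : H.D i (2 : R) = 0 := by
      have := (H.D i).map_natCast 2
      simpa using this
    simp only [mu, map_add, pow_two, Derivation.leibniz, smul_eq_mul, h.D_α, h2]
    ring
  have h3 : (H.K *ᵥ (H.B *ᵥ H.e)) ⬝ᵥ (H.J * H.A) *ᵥ H.e = H.normSqBe - H.ell ^ 2 := by
    have h4 : H.Kᵀ * H.J = 1 - vecMulVec H.ν H.ν - vecMulVec H.e H.e := by
      have := congrArg transpose H.J_mul_K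
      rw [transpose_mul, H.J_transpose] at this
      rw [← neg_neg (H.Kᵀ * H.J), ← mul_neg, this]
      simp [transpose_add, transpose_vecMulVec]
      abel
    rw [← mulVec_mulVec, A_e, ← vecMul_transpose, ← dotProduct_mulVec, mulVec_mulVec, h4,
      sub_mulVec, sub_mulVec, vecMulVec_mulVec, vecMulVec_mulVec, one_mulVec, dotProduct_mulVec,
      ν_vecMul_B]
    simp [normSqBe, ell, dotProduct_comm, pow_two]
  have h5 : ∀ i, (H.K *ᵥ (H.B *ᵥ H.e)) i * H.D i H.mu = (H.K *ᵥ (H.B *ᵥ H.e)) i * H.D i H.lam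
      + 4 * H.α * H.lam * ((H.K *ᵥ (H.B *ᵥ H.e)) i * H.e i) := by
    intro i; rw [h2]; ring
  have h6 : ∑ i, (H.K *ᵥ (H.B *ᵥ H.e)) i * H.e i = 0 := he
  rw [dotProduct]
  simp only [h5, Finset.sum_add_distrib, ← Finset.mul_sum, h6, h1, h3]
  ring

/-! ### The Laplacian of the shape operator -/

theorem D_two (i : ι) : H.D i (2 : R) = 0 := by
  have := (H.D i).map_natCast 2
  simpa using this

/-- Codazzi turns the derivative of `A` in direction `b` into the derivative along `J(ν)`; here the
torsion term of Codazzi vanishes by `K(J(ν)) = 0`. -/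
theorem D_A_e (h : H.StructureEquations) (b k : ι) :
    H.D b ((H.A *ᵥ H.e) k) = ∑ c, H.e c * H.D c (H.A k b)
      + H.ν b * ((H.A * H.A) *ᵥ H.e) k + (H.A * H.J * H.A) k b := by
  have h1 : ∀ c, H.D b (H.A k c * H.e c) = H.e c * H.D c (H.A k b)
      + H.ν b * ((H.A * H.A) k c * H.e c) - (H.A * H.A) k b * (H.ν c * H.e c)
      + 2 * H.mu * H.e k * (H.K b c * H.e c)
      + H.A k c * (H.J * H.A) c b := by
    intro c
    rw [Derivation.leibniz, D_e, smul_eq_mul, smul_eq_mul]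
    linear_combination H.e c * H.codazzi h b c k - 2 * H.mu * H.e k * H.e c * H.K_swap b c
  have h2 : ∑ c, H.ν c * H.e c = 0 := H.ν_dot_e
  have h3 : (H.A *ᵥ H.e) k = ∑ c, H.A k c * H.e c := rfl
  rw [h3, map_sum]
  simp only [h1, Finset.sum_add_distrib, Finset.sum_sub_distrib, ← Finset.mul_sum, h2,
    K_e_apply, sum_mul_e, ← Matrix.mul_apply, Matrix.mul_assoc]
  ring

/-- The sum `∑ c, e c * D c (A k b)` is the only derivative of `A` outside the `ν`-term; it is the
one matched by the first-order part of the modified Laplacian. -/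
theorem D_laplacian_ν (h : H.StructureEquations) (b k : ι) :
    H.D b (∑ i, H.D i (H.A k i)) =
      -(H.ν k * H.D b (H.normSqB + (Fintype.card ι - 2) * H.α ^ 2))
      - (H.normSqB + (Fintype.card ι - 2) * H.α ^ 2) * H.A k b
      - 2 * H.lam * ((H.A *ᵥ H.e) k * H.e b)
      - 2 * H.α * (∑ c, H.e c * H.D c (H.A k b)
      + ((H.A * H.A) *ᵥ H.e) k * H.ν b + (H.A * H.J * H.A) k b) := by
  rw [laplacian_ν H h, map_sub, map_neg, Derivation.leibniz, Derivation.leibniz,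
    Derivation.leibniz, D_two, D_A_e H h, D_ν_eq, h.D_α]
  simp only [smul_eq_mul]
  ring

/-- Commute `T` past `D i` on `ν k` and insert `Tν = μJ(ν)`. This makes the `T` terms of later
commutators computable. -/
theorem T_A (h : H.StructureEquations) (k i : ι) :
    H.T (H.A k i) = H.D i H.mu * H.e k + H.mu * (H.J * H.A) k i + H.α * (H.A * H.A) k i
      - H.mu * (H.A *ᵥ H.e) k * H.ν i + 2 * H.α * H.mu * H.e k * H.e i := by
  have h1 := h.comm_T i (H.ν k)
  simp only [T_ν_eq H h, D_ν_eq, Derivation.leibniz, smul_eq_mul, D_e] at h1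
  have h2 : ∑ c, (-(H.α * H.A c i) + H.ν i * (H.mu * H.e c)) * H.A k c =
      -(H.α * (H.A * H.A) k i) + H.ν i * H.mu * (H.A *ᵥ H.e) k := by
    simp only [Matrix.mul_apply, Finset.mul_sum, mulVec, dotProduct, ← Finset.sum_neg_distrib,
      ← Finset.sum_add_distrib]
    exact Finset.sum_congr rfl fun c _ => by ring
  rw [h2] at h1
  linear_combination -h1

theorem sum_K_mul (k b : ι) :
    ∑ i, H.K b i * H.D i (H.mu * H.e k) =
      H.e k * (H.K *ᵥ fun i => H.D i H.mu) b - H.mu * (H.J * H.A * H.K) k b := by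
  simp only [Derivation.leibniz, smul_eq_mul, D_e, Matrix.mul_apply (M := H.J * H.A), mulVec,
    dotProduct, Finset.mul_sum, ← Finset.sum_sub_distrib]
  exact Finset.sum_congr rfl fun i _ => by rw [H.K_swap b i]; ring

/-- The commutator acts on the functions `A k i`. Its derivative terms along `ν` become `-A²` after
differentiating `Aν = 0`. Its `T` term is evaluated by `T_A`, where the parts along `ν` and `J(ν)`
drop out against `K`. The sum multiplied by `ν b` is left as it is, since contraction with `B`
removes it. -/
theorem sum_comm_A (h : H.StructureEquations) (b k : ι) :
    ∑ i, (H.D i (H.D b (H.A k i)) - H.D b (H.D i (H.A k i))) =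
      -((H.A * H.A * H.A) k b) - (∑ i, ∑ c, H.A c i * H.D c (H.A k i)) * H.ν b
      - 2 * (H.e k * (H.K *ᵥ fun i => H.D i H.mu) b) + 2 * H.mu * (H.J * H.A * H.K) k b
      + 2 * H.α * (H.A * H.A * H.K) k b := by
  have h1 : ∀ c, ∑ i, H.ν i * H.D c (H.A k i) = -(H.A * H.A) k c := by
    intro c
    have h2 : ∑ i, H.A k i * H.ν i = 0 := congrFun H.A_ν k
    have h3 := congrArg (H.D c) h2
    simp only [map_sum, Derivation.leibniz, smul_eq_mul, D_ν_eq, Finset.sum_add_distrib,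
      map_zero] at h3
    rw [Matrix.mul_apply]
    linear_combination h3
  have h4 : ∑ i, ∑ c, (H.ν i * H.A c b - H.ν b * H.A c i) * H.D c (H.A k i) =
      -((H.A * H.A * H.A) k b) - (∑ i, ∑ c, H.A c i * H.D c (H.A k i)) * H.ν b := by
    simp only [sub_mul, Finset.sum_sub_distrib]
    congr 1
    · rw [Finset.sum_comm, Matrix.mul_apply, ← Finset.sum_neg_distrib]
      refine Finset.sum_congr rfl fun c _ => ?_
      rw [← neg_mul, ← h1 c, Finset.sum_mul]
      exact Finset.sum_congr rfl fun i _ => by ring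
    · rw [Finset.sum_mul]
      refine Finset.sum_congr rfl fun i _ => ?_
      rw [Finset.sum_mul]
      exact Finset.sum_congr rfl fun c _ => by ring
  have h5 : ∑ i, H.K b i * H.T (H.A k i) = ∑ i, H.K b i * H.D i (H.mu * H.e k)
      - H.α * (H.A * H.A * H.K) k b := by
    have h6 : (H.A * H.A * H.K) k b = -∑ i, H.K b i * (H.A * H.A) k i := by
      rw [Matrix.mul_apply, ← Finset.sum_neg_distrib]
      exact Finset.sum_congr rfl fun i _ => by rw [H.K_swap b i]; ring
    have h7 : ∀ i, H.K b i * H.T (H.A k i) = H.K b i * H.D i (H.mu * H.e k)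
        + H.α * (H.K b i * (H.A * H.A) k i) - H.mu * (H.A *ᵥ H.e) k * (H.K b i * H.ν i)
        + 2 * H.α * H.mu * H.e k * (H.K b i * H.e i) := by
      intro i
      rw [T_A H h, Derivation.leibniz, D_e]
      simp only [smul_eq_mul]
      ring
    simp only [h7, Finset.sum_add_distrib, Finset.sum_sub_distrib, ← Finset.mul_sum, K_e_apply,
      K_ν_apply, h6]
    ring
  simp only [h.comm_D, Finset.sum_sub_distrib, h4, mul_assoc, ← Finset.mul_sum, h5,
    sum_K_mul]
  simp only [← mul_assoc]
  ring

/-- The divergence of the Codazzi equation. The divergence of `ν i * A²` vanishes, because no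
derivative is taken along `ν` and `tr A = 0`; the divergence of `K` is `div_K`. -/
theorem sum_D_comm_ν (h : H.StructureEquations) (b k : ι) :
    ∑ i, H.D i (H.D i (H.A k b) - H.D b (H.A k i)) =
      -((H.A * H.A * H.Aᵀ) k b) - (∑ i, H.D i ((H.A * H.A) k i)) * H.ν b
      - 2 * H.mu * H.e k * (H.α * (Fintype.card ι - 2) * H.ν b + (H.A *ᵥ H.e) b)
      - 2 * (H.e k * (H.K *ᵥ fun i => H.D i H.mu) b) + 2 * H.mu * (H.J * H.A * H.K) k b := by
  have h1 : ∑ i, H.D i (H.ν i * (H.A * H.A) k b) = 0 := by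
    have h2 := H.D_ν ((H.A * H.A) k b)
    have h3 : ∑ i, H.A i i = 0 := h.trace_A
    simp only [Derivation.leibniz, smul_eq_mul, Finset.sum_add_distrib, h2, D_ν_eq,
      ← Finset.mul_sum, h3]
    ring
  have h4 : ∑ i, H.D i (H.ν b * (H.A * H.A) k i) =
      (H.A * H.A * H.Aᵀ) k b + (∑ i, H.D i ((H.A * H.A) k i)) * H.ν b := by
    simp only [Derivation.leibniz, smul_eq_mul, Finset.sum_add_distrib, D_ν_eq,
      ← Finset.mul_sum]
    rw [Matrix.mul_apply (N := H.Aᵀ)]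
    simp only [transpose_apply]
    ring
  have h5 : ∑ i, H.D i (2 * H.K b i * (H.mu * H.e k)) =
      2 * H.mu * H.e k * (H.α * (Fintype.card ι - 2) * H.ν b + (H.A *ᵥ H.e) b)
      + 2 * ∑ i, H.K b i * H.D i (H.mu * H.e k) := by
    rw [← H.div_K h b, Finset.mul_sum, Finset.mul_sum, ← Finset.sum_add_distrib]
    refine Finset.sum_congr rfl fun i _ => ?_
    rw [Derivation.leibniz, Derivation.leibniz _ 2, D_two]
    simp only [smul_eq_mul]
    ring
  simp only [H.codazzi h, map_sub, Finset.sum_sub_distrib, h1, h4, h5, sum_K_mul]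
  ring

/-- Write `D i D i A k b` as `D b D i A k i`, plus the commutator of `D i` and `D b`, plus `D i` of
the Codazzi defect. The first sum is the derivative of the Laplacian of `ν`. -/
theorem laplacian_A (h : H.StructureEquations) (k b : ι) :
    ∑ i, H.D i (H.D i (H.A k b)) + 2 * H.α * ∑ c, H.e c * H.D c (H.A k b) =
      -(H.ν k * H.D b (H.normSqB + (Fintype.card ι - 2) * H.α ^ 2))
      - (H.normSqB + (Fintype.card ι - 2) * H.α ^ 2) * H.A k b
      - 2 * H.lam * ((H.A *ᵥ H.e) k * H.e b)
      - 2 * H.α * (((H.A * H.A) *ᵥ H.e) k * H.ν b + (H.A * H.J * H.A) k b)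
      + (-((H.A * H.A * H.A) k b) - (∑ i, ∑ c, H.A c i * H.D c (H.A k i)) * H.ν b
      - 2 * (H.e k * (H.K *ᵥ fun i => H.D i H.mu) b) + 2 * H.mu * (H.J * H.A * H.K) k b
      + 2 * H.α * (H.A * H.A * H.K) k b)
      + (-((H.A * H.A * H.Aᵀ) k b) - (∑ i, H.D i ((H.A * H.A) k i)) * H.ν b
      - 2 * H.mu * H.e k * (H.α * (Fintype.card ι - 2) * H.ν b + (H.A *ᵥ H.e) b)
      - 2 * (H.e k * (H.K *ᵥ fun i => H.D i H.mu) b) + 2 * H.mu * (H.J * H.A * H.K) k b) := by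
  rw [← H.sum_D_comm_ν h, ← H.sum_comm_A h]
  have := H.D_laplacian_ν h b k
  simp only [map_sum, map_sub, Finset.sum_sub_distrib] at this ⊢
  linear_combination this

/-! ### Contraction with the symmetrized shape operator -/

theorem contract_eq (h : H.StructureEquations) (M : Matrix ι ι R) :
    ∑ k, ∑ b, H.B k b * M k b = (H.B * M).trace := by
  nth_rewrite 2 [← H.B_transpose h]
  rw [trace, Finset.sum_comm]
  simp [Matrix.mul_apply]

theorem contract_skew (h : H.StructureEquations) {M : Matrix ι ι R} (hM : Mᵀ = -M) :
    ∑ k, ∑ b, H.B k b * M k b = 0 := by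
  rw [contract_eq H h, trace_mul_eq_zero (B_transpose H h) hM]

/-- All rank-one terms with a factor `ν` vanish by `Bν = 0` and `νB = 0`. Those with a factor `J(ν)`
leave `|B(J(ν))|²` or the derivative of `μ` along `K(B(J(ν)))`, and the latter is known from
`D_mu_KBe`. -/
theorem contract_laplacian_A (h : H.StructureEquations) :
    ∑ k, ∑ b, H.B k b *
      (∑ i, H.D i (H.D i (H.A k b)) + 2 * H.α * ∑ c, H.e c * H.D c (H.A k b)) =
    -(H.normSqB + (Fintype.card ι - 2) * H.α ^ 2) * (H.B * H.A).trace
      - 2 * H.lam * H.normSqBe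
      - 2 * H.α * (H.B * H.A * H.K * H.A).trace
      - (H.B * H.A * H.A * H.A).trace
      + 4 * H.lam * (H.normSqBe - H.ell ^ 2)
      + 4 * H.mu * (H.B * H.K * H.A * H.K).trace
      + 2 * H.α * (H.B * H.A * H.A * H.K).trace
      - (H.B * H.A * H.A * H.Aᵀ).trace
      - 2 * H.mu * H.normSqBe := by
  have hAJA : H.A * H.J * H.A = H.A * H.K * H.A := H.mul_J_mul H.A_ν H.ν_vecMul_A
  have hBJA : H.B * H.J * H.A = H.B * H.K * H.A := H.mul_J_mul H.B_ν H.ν_vecMul_A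
  -- The sign comes from moving the skew matrix `K` to the other factor.
  have hw : H.B *ᵥ H.e ⬝ᵥ (H.K *ᵥ fun i => H.D i H.mu) =
      -(H.lam * (H.normSqBe - H.ell ^ 2)) := by
    rw [← D_mu_KBe H h, dotProduct_mulVec, ← mulVec_transpose, K_transpose, neg_mulVec,
      neg_dotProduct]
  have hM : (of fun k b => ∑ i, H.D i (H.D i (H.A k b))
        + 2 * H.α * ∑ c, H.e c * H.D c (H.A k b)) =
      -vecMulVec H.ν (fun b => H.D b (H.normSqB + (Fintype.card ι - 2) * H.α ^ 2))
      - (H.normSqB + (Fintype.card ι - 2) * H.α ^ 2) • H.A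
      - (2 * H.lam) • vecMulVec (H.A *ᵥ H.e) H.e
      - (2 * H.α) • (vecMulVec ((H.A * H.A) *ᵥ H.e) H.ν + H.A * H.K * H.A)
      + (-(H.A * H.A * H.A)
        - vecMulVec (fun k => ∑ i, ∑ c, H.A c i * H.D c (H.A k i)) H.ν
      - (2 : R) • vecMulVec H.e (H.K *ᵥ fun i => H.D i H.mu) + (2 * H.mu) • (H.J * H.A * H.K)
      + (2 * H.α) • (H.A * H.A * H.K))
      + (-(H.A * H.A * H.Aᵀ) - vecMulVec (fun k => ∑ i, H.D i ((H.A * H.A) k i)) H.ν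
      - (2 * H.mu) • vecMulVec H.e ((H.α * (Fintype.card ι - 2)) • H.ν + (H.A *ᵥ H.e))
      - (2 : R) • vecMulVec H.e (H.K *ᵥ fun i => H.D i H.mu)
      + (2 * H.mu) • (H.J * H.A * H.K)) := by
    ext k b
    rw [← hAJA]
    simp only [of_apply, laplacian_A H h, Matrix.add_apply, Matrix.sub_apply, Matrix.neg_apply,
      Matrix.smul_apply, vecMulVec_apply, smul_eq_mul, Pi.add_apply, Pi.smul_apply]
    ring
  have hc := H.contract_eq h (of fun k b => ∑ i, H.D i (H.D i (H.A k b))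
        + 2 * H.α * ∑ c, H.e c * H.D c (H.A k b))
  simp only [of_apply] at hc
  rw [hc, hM]
  have hsw : ∀ v : ι → R, (H.B *ᵥ v) ⬝ᵥ H.ν = 0 := by
    intro v
    rw [dotProduct_comm, dotProduct_mulVec, ν_vecMul_B, zero_dotProduct]
  have hsw2 : (H.B *ᵥ (H.B *ᵥ H.e)) ⬝ᵥ H.e = H.normSqBe := by
    rw [dotProduct_comm, dotProduct_mulVec, ← mulVec_transpose, B_transpose H h, normSqBe]
  have hK : H.B * (H.J * H.A * H.K) = H.B * H.K * H.A * H.K := by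
    rw [← hBJA]; simp only [Matrix.mul_assoc]
  simp only [mul_add, mul_sub, mul_neg, Matrix.mul_smul, trace_add, trace_sub, trace_neg,
    trace_smul, smul_eq_mul, mul_vecMulVec, Matrix.trace_vecMulVec, B_ν, hsw, zero_dotProduct, A_e,
    hsw2, dotProduct_add, dotProduct_smul, hw, hK]
  simp only [← Matrix.mul_assoc, ← normSqBe.eq_1]
  ring

/-- The matrix of the projection onto the orthogonal complement of `ν`. -/
def P : Matrix ι ι R := 1 - vecMulVec H.ν H.ν

/-- The entrywise derivative of `B`. -/
def DB (i : ι) : Matrix ι ι R := of fun k b => H.D i (H.B k b)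

/-- The squared norm of the tangential part of the derivative of `B`. -/
def normSqTangentialDB : R := ∑ i, ∑ j, ∑ k, (H.P * H.DB i * H.P) j k ^ 2

omit [DecidableEq ι] [Algebra ℝ R] in
theorem sum_sq_eq_trace (M : Matrix ι ι R) : ∑ j, ∑ k, M j k ^ 2 = (M * Mᵀ).trace := by
  simp [trace, Matrix.mul_apply, pow_two]

/-- Differentiate `Bν = 0`: the normal part of the derivative of `B` involves no derivative of `B`.
-/
theorem DB_ν (i : ι) : H.DB i *ᵥ H.ν = -(H.B *ᵥ fun c => H.A c i) := by
  ext k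
  have h2 : ∑ c, H.B k c * H.ν c = 0 := congrFun H.B_ν k
  have h3 := congrArg (H.D i) h2
  simp only [map_sum, Derivation.leibniz, smul_eq_mul, D_ν_eq, Finset.sum_add_distrib,
    map_zero] at h3
  simp only [mulVec, dotProduct, DB, of_apply, Pi.neg_apply]
  rw [Finset.sum_congr rfl fun c _ => mul_comm (H.ν c) _] at h3
  linear_combination h3

theorem DB_transpose (h : H.StructureEquations) (i : ι) : (H.DB i)ᵀ = H.DB i := by
  ext j k
  simp only [DB, transpose_apply, of_apply]
  congr 1
  exact congrFun (congrFun (H.B_transpose h) j) k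

theorem ν_vecMul_DB (h : H.StructureEquations) (i : ι) :
    H.ν ᵥ* H.DB i = -(H.B *ᵥ fun c => H.A c i) := by
  rw [← DB_ν, ← mulVec_transpose, DB_transpose H h]

/-- With `u` the image under `B` of the `i`-th column of `A`, the matrix `DB i` is its tangential
part minus `ν ⊗ u` and `u ⊗ ν`. These three are mutually orthogonal as `u` is orthogonal to `ν`, so
the normal part contributes `2|u|²`. -/
theorem sum_sq_DB (h : H.StructureEquations) :
    ∑ i, ∑ j, ∑ k, H.DB i j k ^ 2 =
      H.normSqTangentialDB + 2 * (H.B * H.B * H.A * H.Aᵀ).trace := by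
  have hi : ∀ i, ∑ j, ∑ k, H.DB i j k ^ 2 = ∑ j, ∑ k, (H.P * H.DB i * H.P) j k ^ 2
      + 2 * ((H.B *ᵥ fun c => H.A c i) ⬝ᵥ (H.B *ᵥ fun c => H.A c i)) := by
    intro i
    have huν : (H.B *ᵥ fun c => H.A c i) ⬝ᵥ H.ν = 0 := by
      rw [dotProduct_comm, dotProduct_mulVec, ν_vecMul_B, zero_dotProduct]
    have hνu : H.ν ⬝ᵥ (H.B *ᵥ fun c => H.A c i) = 0 := by
      rw [dotProduct_comm, huν]
    have h1 := H.DB_ν i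
    have h2 := H.ν_vecMul_DB h i
    have h3 := H.DB_transpose h i
    generalize (H.B *ᵥ fun c => H.A c i) = u at *
    have h4 : H.P * H.DB i * H.P = H.DB i + vecMulVec H.ν u + vecMulVec u H.ν := by
      simp [P, mul_sub, sub_mul, vecMulVec_mul, mul_vecMulVec, h1, h2, vecMulVec_mulVec, huν,
        add_mulVec]
    rw [h4, sum_sq_eq_trace, sum_sq_eq_trace]
    have h5 : H.DB i *ᵥ u ⬝ᵥ H.ν = -(u ⬝ᵥ u) := by
      rw [dotProduct_comm, dotProduct_mulVec, h2, neg_dotProduct]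
    have h6 : H.ν ⬝ᵥ u ᵥ* H.DB i = -(u ⬝ᵥ u) := by
      rw [← mulVec_transpose, h3, dotProduct_mulVec, h2, neg_dotProduct]
    simp [h3, transpose_vecMulVec, mul_add, add_mul, vecMulVec_mul, mul_vecMulVec, h1, h2,
      vecMulVec_mulVec, huν, hνu, H.norm_ν, h5, h6]
    ring
  have ht : (H.B * H.B * H.A * H.Aᵀ).trace =
      ∑ i, (H.B *ᵥ fun c => H.A c i) ⬝ᵥ (H.B *ᵥ fun c => H.A c i) := by
    have : H.B * H.B * H.A * H.Aᵀ = H.B * (H.B * H.A * H.Aᵀ) := by simp only [Matrix.mul_assoc]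
    rw [this, trace_mul_comm]
    nth_rewrite 2 [← H.B_transpose h]
    rw [Matrix.mul_assoc, ← transpose_mul, ← sum_sq_eq_trace, Finset.sum_comm]
    simp [Matrix.mul_apply, dotProduct, mulVec, pow_two]
  simp only [hi, Finset.sum_add_distrib, ht, normSqTangentialDB, Finset.mul_sum]

/-- Substitute `A = B - αK` and `Aᵀ = B + αK`. The `B⁴` parts cancel in the first identity. Traces
with an odd number of factors `K` vanish by symmetry, and those with two are `trace_BBKK` or
`innerBJ`, according to whether the factors `K` are adjacent. -/
theorem sum_traces (h : H.StructureEquations) :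
    2 * (H.B * H.B * H.A * H.Aᵀ).trace - (H.B * H.A * H.A * H.A).trace
      - (H.B * H.A * H.A * H.Aᵀ).trace = 4 * H.α ^ 2 * (H.normSqB - H.normSqBe) ∧
    (H.B * H.A).trace = H.normSqB ∧
    (H.B * H.A * H.K * H.A).trace = 2 * H.α * (H.normSqB - H.normSqBe) ∧
    (H.B * H.K * H.A * H.K).trace = -H.innerBJ ∧
    (H.B * H.A * H.A * H.K).trace = H.α * (H.normSqB - H.normSqBe) + H.α * H.innerBJ := by
  rw [A_transpose H h, A_eq]
  set B := H.B
  set K := H.K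
  have t1 : (B * K).trace = 0 := H.trace_BK h
  have t2 : (B * B * B * K).trace = 0 := H.trace_BBBK h
  have t3 : (B * B * K * K).trace = H.normSqBe - H.normSqB := by
    rw [Matrix.mul_assoc (B * B), H.trace_BBKK h]
  have t4 : (B * K * K * K).trace = 0 := H.trace_BKKK h
  have t5 : (B * K * B * K).trace = -H.innerBJ := by simp [innerBJ, B, K]
  have t6 : (B * B).trace = H.normSqB := (H.normSqB_eq h).symm
  have r1 : (B * B * K * B).trace = 0 := by
    rw [trace_mul_comm, ← t2]; simp only [Matrix.mul_assoc]
  have r2 : (B * K * B * B).trace = 0 := by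
    rw [trace_mul_comm, ← r1]; simp only [Matrix.mul_assoc]
  have r3 : (B * K * K * B).trace = H.normSqBe - H.normSqB := by
    rw [trace_mul_comm, ← t3]; simp only [Matrix.mul_assoc]
  simp only [mul_sub, sub_mul, mul_add, Matrix.mul_smul, smul_mul, trace_add, trace_sub,
    trace_smul, smul_eq_mul, t1, t2, t3, t4, t5, t6, r1, r2, r3]
  refine ⟨?_, ?_, ?_, ?_, ?_⟩ <;> ring

/-- The contracted Simons formula. -/
theorem simons (h : H.StructureEquations) :
    ∑ i, H.D i (H.D i H.normSqB) + 2 * H.α * ∑ i, H.e i * H.D i H.normSqB =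
      2 * (H.normSqTangentialDB
        - (H.normSqB + 4 * H.lam + (Fintype.card ι + 2) * H.α ^ 2) * H.normSqB
        + 6 * H.α ^ 2 * H.normSqB - 6 * H.α ^ 2 * H.normSqBe + 4 * H.lam * H.normSqB
        - 4 * H.lam * H.ell ^ 2 - (4 * H.lam + 6 * H.α ^ 2) * H.innerBJ) := by
  have h1 : ∀ i, H.D i H.normSqB = 2 * ∑ k, ∑ b, H.B k b * H.D i (H.B k b) := by
    intro i
    simp only [normSqB, pow_two, map_sum, Derivation.leibniz, smul_eq_mul, Finset.mul_sum]
    exact Finset.sum_congr rfl fun k _ => Finset.sum_congr rfl fun b _ => by ring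
  have h2 : ∀ i, H.D i (H.D i H.normSqB) = 2 * ∑ k, ∑ b, H.B k b * H.D i (H.D i (H.B k b))
      + 2 * ∑ k, ∑ b, H.DB i k b ^ 2 := by
    intro i
    rw [h1, Derivation.leibniz, D_two, ← mul_add]
    simp only [map_sum, Derivation.leibniz, smul_eq_mul, mul_zero, add_zero,
      ← Finset.sum_add_distrib]
    congr 1
    refine Finset.sum_congr rfl fun k _ => Finset.sum_congr rfl fun b _ => ?_
    simp only [DB, of_apply]
    ring
  -- `B - A = αK` is skew entrywise, hence so is anything obtained from it by a scalar operator, and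
  -- its contraction with the symmetric `B` is zero.
  have h3 : ∑ k, ∑ b, H.B k b *
      (∑ i, H.D i (H.D i (H.B k b)) + 2 * H.α * ∑ c, H.e c * H.D c (H.B k b)) =
      ∑ k, ∑ b, H.B k b *
      (∑ i, H.D i (H.D i (H.A k b)) + 2 * H.α * ∑ c, H.e c * H.D c (H.A k b)) := by
    have hB : ∀ k b, H.B k b = H.A k b + H.α * H.K k b := fun _ _ => rfl
    have hs := H.contract_skew h (M := of fun k b => ∑ i, H.D i (H.D i (H.α * H.K k b))
        + 2 * H.α * ∑ c, H.e c * H.D c (H.α * H.K k b)) (by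
      ext k b
      simp only [transpose_apply, of_apply, Matrix.neg_apply, H.K_swap k b, mul_neg, map_neg,
        Finset.sum_neg_distrib]
      ring)
    rw [← sub_eq_zero, ← Finset.sum_sub_distrib, ← hs]
    refine Finset.sum_congr rfl fun k _ => ?_
    rw [← Finset.sum_sub_distrib]
    refine Finset.sum_congr rfl fun b _ => ?_
    rw [← mul_sub]
    congr 1
    simp only [hB, map_add, of_apply, Finset.sum_add_distrib, mul_add]
    ring
  have h4 : ∑ i, H.D i (H.D i H.normSqB) + 2 * H.α * ∑ i, H.e i * H.D i H.normSqB =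
      2 * (∑ k, ∑ b, H.B k b *
      (∑ i, H.D i (H.D i (H.B k b)) + 2 * H.α * ∑ c, H.e c * H.D c (H.B k b)))
      + 2 * ∑ i, ∑ k, ∑ b, H.DB i k b ^ 2 := by
    have e1 : ∑ i, ∑ k, ∑ b, H.B k b * H.D i (H.D i (H.B k b)) =
        ∑ k, ∑ b, H.B k b * ∑ i, H.D i (H.D i (H.B k b)) := by
      rw [Finset.sum_comm]
      refine Finset.sum_congr rfl fun k _ => ?_
      rw [Finset.sum_comm]
      exact Finset.sum_congr rfl fun b _ => by rw [Finset.mul_sum]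
    have e2 : ∑ i, H.e i * (2 * ∑ k, ∑ b, H.B k b * H.D i (H.B k b)) =
        2 * ∑ k, ∑ b, H.B k b * ∑ i, H.e i * H.D i (H.B k b) := by
      simp only [Finset.mul_sum]
      rw [Finset.sum_comm]
      refine Finset.sum_congr rfl fun k _ => ?_
      rw [Finset.sum_comm]
      exact Finset.sum_congr rfl fun b _ => Finset.sum_congr rfl fun i _ => by ring
    have e3 : ∑ k, ∑ b, H.B k b * (2 * H.α * ∑ c, H.e c * H.D c (H.B k b)) =
        2 * H.α * ∑ k, ∑ b, H.B k b * ∑ i, H.e i * H.D i (H.B k b) := by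
      simp only [Finset.mul_sum]
      exact Finset.sum_congr rfl fun k _ => Finset.sum_congr rfl fun b _ =>
        Finset.sum_congr rfl fun i _ => by ring
    simp only [h2, Finset.sum_add_distrib, mul_add, ← Finset.mul_sum]
    simp only [h1]
    rw [e1, e2, e3]
    ring
  obtain ⟨s1, s2, s3, s4, s5⟩ := H.sum_traces h
  rw [h4, h3, contract_laplacian_A H h, sum_sq_DB H h, s2, s3, s4, s5, mu]
  -- With `μ = λ + 2α²` the terms in `λ|B(J(ν))|²` cancel, so only `-4λℓ²` is left of them.
  linear_combination 2 * s1

end HorizontalCalculus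

/-! ### Smooth functions on an open set and their derivations -/

section SmoothFunctions

variable {E : Type*} [NormedAddCommGroup E] [NormedSpace ℝ E] {W : Set E}

open Classical in
/-- The extension by zero of a function on a set. -/
noncomputable def extendZero (f : W → ℝ) (x : E) : ℝ := if h : x ∈ W then f ⟨x, h⟩ else 0

omit [NormedAddCommGroup E] [NormedSpace ℝ E] in
theorem extendZero_apply (f : W → ℝ) (x : W) : extendZero f x = f x := by simp [extendZero]

variable (W) in
/-- The algebra of smooth functions on an open set. -/
noncomputable def smoothFunctions : Subalgebra ℝ (W → ℝ) where
  carrier := {f | ContDiffOn ℝ ∞ (extendZero f) W}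
  mul_mem' {f g} hf hg := by
    refine (ContDiffOn.mul hf hg).congr fun x hx => ?_
    simp [extendZero, hx]
  add_mem' {f g} hf hg := by
    refine (ContDiffOn.add hf hg).congr fun x hx => ?_
    simp [extendZero, hx]
  algebraMap_mem' r := by
    refine (contDiffOn_const (c := r)).congr fun x hx => ?_
    simp [extendZero, hx]

namespace smoothFunctions

/-- The restriction of a smooth function to `W`. -/
noncomputable def restrict (g : E → ℝ) (hg : ContDiffOn ℝ ∞ g W) : smoothFunctions W :=
  ⟨fun x => g x, hg.congr fun x hx => by simp [extendZero, hx]⟩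

/-- The value of a smooth function on `W` at a point, zero outside of `W`. -/
noncomputable def eval (f : smoothFunctions W) : E → ℝ := extendZero f.1

theorem contDiffOn_eval (f : smoothFunctions W) : ContDiffOn ℝ ∞ (eval f) W := f.2

theorem eval_restrict {g : E → ℝ} (hg : ContDiffOn ℝ ∞ g W) {x : E} (hx : x ∈ W) :
    eval (restrict g hg) x = g x := by simp [eval, extendZero, hx, restrict]

theorem ext_eval {f g : smoothFunctions W} (h : ∀ x ∈ W, eval f x = eval g x) : f = g := by
  refine Subtype.ext (funext fun x => ?_)
  simpa [eval, extendZero_apply] using h x x.2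

theorem eval_add (f g : smoothFunctions W) (x : E) : eval (f + g) x = eval f x + eval g x := by
  by_cases hx : x ∈ W <;> simp [eval, extendZero, hx]

theorem eval_neg (f : smoothFunctions W) (x : E) : eval (-f) x = -eval f x := by
  by_cases hx : x ∈ W <;> simp [eval, extendZero, hx]

theorem eval_sub (f g : smoothFunctions W) (x : E) : eval (f - g) x = eval f x - eval g x := by
  by_cases hx : x ∈ W <;> simp [eval, extendZero, hx]

theorem eval_mul (f g : smoothFunctions W) (x : E) : eval (f * g) x = eval f x * eval g x := by
  by_cases hx : x ∈ W <;> simp [eval, extendZero, hx]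

theorem eval_smul (r : ℝ) (f : smoothFunctions W) (x : E) : eval (r • f) x = r * eval f x := by
  by_cases hx : x ∈ W <;> simp [eval, extendZero, hx]

theorem eval_zero (x : E) : eval (0 : smoothFunctions W) x = 0 := by
  by_cases hx : x ∈ W <;> simp [eval, extendZero, hx]

theorem eval_one {x : E} (hx : x ∈ W) : eval (1 : smoothFunctions W) x = 1 := by
  simp [eval, extendZero, hx]

theorem eval_algebraMap (r : ℝ) {x : E} (hx : x ∈ W) :
    eval (algebraMap ℝ (smoothFunctions W) r) x = r := by
  simp [eval, extendZero, hx]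

theorem eval_pow (f : smoothFunctions W) (k : ℕ) {x : E} (hx : x ∈ W) :
    eval (f ^ k) x = eval f x ^ k := by
  simp [eval, extendZero, hx]

theorem eval_two {x : E} (hx : x ∈ W) : eval (2 : smoothFunctions W) x = 2 := by
  rw [← one_add_one_eq_two, eval_add, eval_one hx]
  norm_num

theorem eval_sum {ι : Type*} (s : Finset ι) (f : ι → smoothFunctions W) (x : E) :
    eval (∑ i ∈ s, f i) x = ∑ i ∈ s, eval (f i) x := by
  classical
  induction s using Finset.induction_on with
  | empty => simp [eval_zero]
  | insert a s ha ih => simp [Finset.sum_insert ha, eval_add, ih]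

/-- Since `W` is open, the values chosen outside `W` do not affect derivatives at its points. -/
theorem eventuallyEq_eval_restrict (hW : IsOpen W) {g : E → ℝ} (hg : ContDiffOn ℝ ∞ g W) {x : E}
    (hx : x ∈ W) : eval (restrict g hg) =ᶠ[nhds x] g := by
  filter_upwards [hW.mem_nhds hx] with y hy using eval_restrict hg hy

theorem differentiableAt_eval (hW : IsOpen W) (f : smoothFunctions W) {x : E} (hx : x ∈ W) :
    DifferentiableAt ℝ (eval f) x :=
  ((contDiffOn_eval f).contDiffAt (hW.mem_nhds hx)).differentiableAt (by simp)

theorem contDiffOn_fderiv_apply {F : Type*} [NormedAddCommGroup F] [NormedSpace ℝ F]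
    (hW : IsOpen W) {g : E → F} (hg : ContDiffOn ℝ ∞ g W) {V : E → E}
    (hV : ContDiffOn ℝ ∞ V W) : ContDiffOn ℝ ∞ (fun x => fderiv ℝ g x (V x)) W :=
  (hg.fderiv_of_isOpen hW (by simp)).clm_apply hV

/-- The derivation of the algebra of smooth functions defined by a smooth vector field. -/
noncomputable def derivation (hW : IsOpen W) (V : E → E) (hV : ContDiffOn ℝ ∞ V W) :
    Derivation ℝ (smoothFunctions W) (smoothFunctions W) :=
  Derivation.mk'
    { toFun := fun f => restrict _ (contDiffOn_fderiv_apply hW (contDiffOn_eval f) hV)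
      map_add' := fun f g => by
        refine ext_eval fun x hx => ?_
        have : eval (f + g) = eval f + eval g := funext (eval_add f g)
        rw [eval_add, eval_restrict _ hx, eval_restrict _ hx, eval_restrict _ hx, this,
          fderiv_add (differentiableAt_eval hW f hx) (differentiableAt_eval hW g hx)]
        rfl
      map_smul' := fun r f => by
        refine ext_eval fun x hx => ?_
        have : eval (r • f) = r • eval f := funext (eval_smul r f)
        rw [RingHom.id_apply, eval_smul, eval_restrict _ hx, eval_restrict _ hx, this,
          fderiv_const_smul (differentiableAt_eval hW f hx)]
        rfl }
    (fun f g => by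
      refine ext_eval fun x hx => ?_
      have : eval (f * g) = eval f * eval g := funext (eval_mul f g)
      simp only [LinearMap.coe_mk, AddHom.coe_mk, smul_eq_mul]
      rw [eval_add, eval_mul, eval_mul, eval_restrict _ hx, eval_restrict _ hx, eval_restrict _ hx, this,
        fderiv_mul (differentiableAt_eval hW f hx) (differentiableAt_eval hW g hx)]
      rfl)

theorem eval_derivation (hW : IsOpen W) {V : E → E} (hV : ContDiffOn ℝ ∞ V W)
    (f : smoothFunctions W) {x : E} (hx : x ∈ W) :
    eval (derivation hW V hV f) x = fderiv ℝ (eval f) x (V x) :=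
  eval_restrict _ hx

theorem eval_derivation_restrict (hW : IsOpen W) {V : E → E} (hV : ContDiffOn ℝ ∞ V W)
    {g : E → ℝ} (hg : ContDiffOn ℝ ∞ g W) {x : E} (hx : x ∈ W) :
    eval (derivation hW V hV (restrict g hg)) x = fderiv ℝ g x (V x) := by
  rw [eval_derivation hW hV _ hx, (eventuallyEq_eval_restrict hW hg hx).fderiv_eq]

end smoothFunctions

/-- The commutator of two derivatives is the derivative along the Lie bracket. -/
theorem fderiv_fderiv_apply_sub {F : Type*} [NormedAddCommGroup F] [NormedSpace ℝ F] {g : E → F}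
    {x : E} (hg : ContDiffAt ℝ ∞ g x) {V U : E → E} (hV : DifferentiableAt ℝ V x)
    (hU : DifferentiableAt ℝ U x) :
    fderiv ℝ (fun y => fderiv ℝ g y (U y)) x (V x) - fderiv ℝ (fun y => fderiv ℝ g y (V y)) x (U x)
      = fderiv ℝ g x (VectorField.lieBracket ℝ V U x) := by
  have hd : DifferentiableAt ℝ (fderiv ℝ g) x :=
    (hg.fderiv_right (m := 1) (by norm_cast)).differentiableAt (by simp)
  have hs : IsSymmSndFDerivAt ℝ g x :=
    hg.isSymmSndFDerivAt (by
      rw [minSmoothness_of_isRCLikeNormedField]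
      exact ENat.LEInfty.out)
  rw [fderiv_clm_apply hd hU, fderiv_clm_apply hd hV, VectorField.lieBracket, map_sub]
  simp only [add_apply, ContinuousLinearMap.comp_apply, ContinuousLinearMap.flip_apply]
  rw [hs.eq]
  abel

end SmoothFunctions

namespace Heisenberg

variable {n : ℕ}

/-! ### The complex structure and the left-invariant frame -/

theorem inner_J (a b : Hor n) : inner ℝ (J a) b = ∑ j : Fin n,
    (a (Sum.inl j) * b (Sum.inr j) - a (Sum.inr j) * b (Sum.inl j)) := by
  simp only [J, PiLp.inner_apply, Fintype.sum_sum_type, Sum.elim_inl, Sum.elim_inr,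
    RCLike.inner_apply, conj_trivial, Finset.sum_sub_distrib, mul_neg, Finset.sum_neg_distrib]
  rw [add_comm, ← sub_eq_add_neg]
  congr 1 <;> exact Finset.sum_congr rfl fun j _ => mul_comm _ _

/-- The complex structure as a linear map. -/
noncomputable def JL : Hor n →L[ℝ] Hor n :=
  LinearMap.toContinuousLinearMap
    { toFun := J
      map_add' := fun a b => by ext (j | j) <;> simp [J, add_comm]
      map_smul' := fun r a => by ext (j | j) <;> simp [J] }

@[simp] theorem JL_apply (a : Hor n) : JL a = J a := rfl

theorem J_add (a b : Hor n) : J (a + b) = J a + J b := (JL (n := n)).map_add a b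
theorem J_sub (a b : Hor n) : J (a - b) = J a - J b := (JL (n := n)).map_sub a b
theorem J_smul (r : ℝ) (a : Hor n) : J (r • a) = r • J a := (JL (n := n)).map_smul r a

theorem inner_J_left (a b : Hor n) : inner ℝ (J a) b = -inner ℝ a (J b) := by
  rw [real_inner_comm (J b), inner_J, inner_J, ← Finset.sum_neg_distrib]
  exact Finset.sum_congr rfl fun j _ => by ring

theorem J_J (a : Hor n) : J (J a) = -a := by
  ext (j | j) <;> simp [J]

theorem inner_J_self (a : Hor n) : inner ℝ (J a) a = 0 := by
  rw [inner_J]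
  exact Finset.sum_eq_zero fun j _ => by ring

theorem frameVec_eq (p c : Heis n) : frameVec p c = (c.1, c.2 + inner ℝ (J c.1) p.1) := by
  rw [inner_J, frameVec]

theorem frameCoeff_eq (p c : Heis n) : frameCoeff p c = (c.1, c.2 - inner ℝ (J c.1) p.1) := by
  rw [inner_J, frameCoeff]

theorem frameVec_add (p c d : Heis n) : frameVec p (c + d) = frameVec p c + frameVec p d := by
  simp only [frameVec_eq, Prod.fst_add, Prod.snd_add, J_add, inner_add_left, Prod.mk_add_mk]
  congr 1; ring

theorem frameVec_smul (p : Heis n) (r : ℝ) (c : Heis n) :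
    frameVec p (r • c) = r • frameVec p c := by
  simp only [frameVec_eq, Prod.smul_fst, Prod.smul_snd, J_smul, inner_smul_left, Prod.smul_mk,
    smul_eq_mul, conj_trivial]
  congr 1; ring

theorem frameVec_sub (p c d : Heis n) : frameVec p (c - d) = frameVec p c - frameVec p d := by
  rw [sub_eq_add_neg, ← neg_one_smul ℝ d, frameVec_add, frameVec_smul, neg_one_smul,
    sub_eq_add_neg]

theorem frameVec_add_vertical (p c : Heis n) (s : ℝ) :
    frameVec p c + (0, s) = frameVec p (c + (0, s)) := by
  simp only [frameVec_eq, Prod.mk_add_mk, add_zero, Prod.fst_add, Prod.snd_add]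
  congr 1; ring

theorem frameCoeff_add (p c d : Heis n) :
    frameCoeff p (c + d) = frameCoeff p c + frameCoeff p d := by
  simp only [frameCoeff_eq, Prod.fst_add, Prod.snd_add, J_add, inner_add_left, Prod.mk_add_mk]
  congr 1; ring

theorem frameCoeff_smul (p : Heis n) (r : ℝ) (c : Heis n) :
    frameCoeff p (r • c) = r • frameCoeff p c := by
  simp only [frameCoeff_eq, Prod.smul_fst, Prod.smul_snd, J_smul, inner_smul_left, Prod.smul_mk,
    smul_eq_mul, conj_trivial]
  congr 1; ring

theorem metric_add_right (c d d' : Heis n) : metric c (d + d') = metric c d + metric c d' := by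
  simp [metric, inner_add_right]; ring

theorem metric_smul_right (c d : Heis n) (r : ℝ) : metric c (r • d) = r * metric c d := by
  simp [metric, inner_smul_right]; ring

section

variable {E : Type*} [NormedAddCommGroup E] [NormedSpace ℝ E]

theorem _root_.ContDiffOn.frameVec {s : Set E} {G c : E → Heis n} (hG : ContDiffOn ℝ ∞ G s)
    (hc : ContDiffOn ℝ ∞ c s) : ContDiffOn ℝ ∞ (fun x => frameVec (G x) (c x)) s := by
  have h : ContDiffOn ℝ ∞ (fun x => ((c x).1, (c x).2 + inner ℝ (JL (c x).1) (G x).1)) s :=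
    hc.fst.prodMk (hc.snd.add ((JL.contDiff.comp_contDiffOn hc.fst).inner ℝ hG.fst))
  exact h.congr fun x _ => frameVec_eq _ _

/-- The derivative of a vector field along a map given by its coefficients in the left-invariant
frame. -/
theorem fderiv_frameVec {G c : E → Heis n} {x : E} (hG : DifferentiableAt ℝ G x)
    (hc : DifferentiableAt ℝ c x) (v : E) :
    fderiv ℝ (fun y => frameVec (G y) (c y)) x v =
      frameVec (G x) (fderiv ℝ c x v) + (0, inner ℝ (J (c x).1) (fderiv ℝ G x v).1) := by
  have h : (fun y => frameVec (G y) (c y)) =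
      fun y => ((c y).1, (c y).2 + inner ℝ (JL (c y).1) (G y).1) :=
    funext fun y => frameVec_eq _ _
  have h1 : HasFDerivAt (fun y => (c y).1)
      ((ContinuousLinearMap.fst ℝ (Hor n) ℝ).comp (fderiv ℝ c x)) x := hc.hasFDerivAt.fst
  have h2 : HasFDerivAt (fun y => (c y).2)
      ((ContinuousLinearMap.snd ℝ (Hor n) ℝ).comp (fderiv ℝ c x)) x := hc.hasFDerivAt.snd
  have h3 : HasFDerivAt (fun y => (G y).1)
      ((ContinuousLinearMap.fst ℝ (Hor n) ℝ).comp (fderiv ℝ G x)) x := hG.hasFDerivAt.fst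
  have h4 : HasFDerivAt (fun y => ((c y).1, (c y).2 + inner ℝ (JL (c y).1) (G y).1)) _ x :=
    h1.prodMk (h2.add (((JL (n := n)).hasFDerivAt.comp x h1).inner ℝ h3))
  rw [h, h4.fderiv, frameVec_eq]
  refine Prod.ext ?_ ?_
  · simp
  · simp
    ring

end

end Heisenberg

/-! ### Parametrized hypersurfaces and their tangent fields -/

namespace Heisenberg

/-- A parametrized hypersurface `G` in the Heisenberg group without characteristic points, with
unit normal `N`, on an open set `W` of a vector space. -/
structure LocalHypersurface (n : ℕ) (E : Type*) [NormedAddCommGroup E] [NormedSpace ℝ E] where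
  W : Set E
  G : E → Heis n
  N : E → Heis n
  isOpen : IsOpen W
  contDiffOn_G : ContDiffOn ℝ ∞ G W
  contDiffOn_N : ContDiffOn ℝ ∞ N W
  injective : ∀ x ∈ W, Function.Injective (fderiv ℝ G x)
  unit : ∀ x ∈ W, metric (N x) (N x) = 1
  normal : ∀ x ∈ W, ∀ v, metric (N x) (frameCoeff (G x) (fderiv ℝ G x v)) = 0
  horizontal_ne_zero : ∀ x ∈ W, (N x).1 ≠ 0

namespace LocalHypersurface

variable {n : ℕ} {E : Type*} [NormedAddCommGroup E] [NormedSpace ℝ E]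
  (S : LocalHypersurface n E)

/-- The horizontal unit normal. -/
noncomputable def ν (x : E) : Hor n := nu S.N x

/-- The fundamental function. -/
noncomputable def α (x : E) : ℝ := alpha S.N x

theorem contDiffOn_ν : ContDiffOn ℝ ∞ S.ν S.W := by
  have h1 : ContDiffOn ℝ ∞ (fun x => (S.N x).1) S.W := S.contDiffOn_N.fst
  have h2 : ContDiffOn ℝ ∞ (fun x => ‖(S.N x).1‖) S.W := h1.norm ℝ S.horizontal_ne_zero
  exact (h2.inv fun x hx => norm_ne_zero_iff.2 (S.horizontal_ne_zero x hx)).smul h1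

theorem contDiffOn_α : ContDiffOn ℝ ∞ S.α S.W := by
  have h1 : ContDiffOn ℝ ∞ (fun x => (S.N x).1) S.W := S.contDiffOn_N.fst
  have h2 : ContDiffOn ℝ ∞ (fun x => ‖(S.N x).1‖) S.W := h1.norm ℝ S.horizontal_ne_zero
  exact S.contDiffOn_N.snd.div h2 fun x hx => norm_ne_zero_iff.2 (S.horizontal_ne_zero x hx)

variable {S} {x : E}

theorem inner_ν_ν (hx : x ∈ S.W) : inner ℝ (S.ν x) (S.ν x) = 1 := by
  have := norm_ne_zero_iff.2 (S.horizontal_ne_zero x hx)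
  rw [ν, nu, real_inner_self_eq_norm_sq, norm_smul, norm_inv, norm_norm]
  field_simp

theorem metric_N (hx : x ∈ S.W) (c : Heis n) :
    metric (S.N x) c = ‖(S.N x).1‖ * (inner ℝ c.1 (S.ν x) + S.α x * c.2) := by
  have := norm_ne_zero_iff.2 (S.horizontal_ne_zero x hx)
  rw [metric, ν, α, nu, alpha, inner_smul_right, real_inner_comm]
  field_simp

/-- `N` is a positive multiple of `ν + αT`, so this is the tangency condition in frame coefficients.
-/
theorem metric_N_eq_zero (hx : x ∈ S.W) (c : Heis n) :
    metric (S.N x) c = 0 ↔ inner ℝ c.1 (S.ν x) = -(S.α x * c.2) := by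
  have := norm_ne_zero_iff.2 (S.horizontal_ne_zero x hx)
  rw [metric_N hx, mul_eq_zero_iff_left this]
  constructor <;> intro h <;> linarith

variable (S)

/-- The identification of `E × ℝ` with the tangent space of the Heisenberg group given by the
differential of the parametrization and by the unit normal. -/
noncomputable def frame (x : E) : E × ℝ →L[ℝ] Heis n :=
  (fderiv ℝ S.G x).comp (ContinuousLinearMap.fst ℝ E ℝ) +
    (ContinuousLinearMap.snd ℝ E ℝ).smulRight (frameVec (S.G x) (S.N x))

variable {S}

theorem frame_apply (v : E × ℝ) :
    S.frame x v = fderiv ℝ S.G x v.1 + v.2 • frameVec (S.G x) (S.N x) := rfl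

theorem metric_frame (hx : x ∈ S.W) (v : E × ℝ) :
    metric (S.N x) (frameCoeff (S.G x) (S.frame x v)) = v.2 := by
  rw [frame_apply, frameCoeff_add, frameCoeff_smul, frameCoeff_frameVec, metric_add_right,
    metric_smul_right, S.normal x hx, S.unit x hx]
  ring

theorem frame_injective (hx : x ∈ S.W) : Function.Injective (S.frame x) := by
  rw [injective_iff_map_eq_zero]
  intro v hv
  have h1 := metric_frame hx v
  have h2 : frameCoeff (S.G x) (0 : Heis n) = 0 := by
    have := frameCoeff_smul (S.G x) 0 (0 : Heis n)
    simpa using this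
  rw [hv, h2] at h1
  have h3 : v.2 = 0 := by rw [← h1]; simp [metric]
  rw [frame_apply, h3, zero_smul, add_zero] at hv
  have h4 : v.1 = 0 := S.injective x hx (by rw [hv, map_zero])
  exact Prod.ext h4 h3

section

variable [FiniteDimensional ℝ E] (hE : Module.finrank ℝ E = 2 * n)
include hE

theorem exists_equiv (hx : x ∈ S.W) : ∃ e : (E × ℝ) ≃L[ℝ] Heis n, (e : E × ℝ →L[ℝ] Heis n) =
    S.frame x := by
  have hd : Module.finrank ℝ (E × ℝ) = Module.finrank ℝ (Heis n) := by
    simp [hE]; ring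
  refine ⟨(LinearMap.linearEquivOfInjective (S.frame x : E × ℝ →ₗ[ℝ] Heis n)
    (frame_injective hx) hd).toContinuousLinearEquiv, ?_⟩
  ext <;> rfl

theorem frame_inverse (hx : x ∈ S.W) (w : Heis n) :
    S.frame x ((S.frame x).inverse w) = w := by
  obtain ⟨e, he⟩ := exists_equiv hE hx
  rw [← he, ContinuousLinearMap.inverse_equiv]
  simp

/-- The second component of the inverse is the component along `N`. It vanishes for a tangent
vector, so the first component alone is a preimage. -/
theorem fderiv_inverse (hx : x ∈ S.W) {c : Heis n} (hc : inner ℝ c.1 (S.ν x) = -(S.α x * c.2)) :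
    fderiv ℝ S.G x ((S.frame x).inverse (frameVec (S.G x) c)).1 = frameVec (S.G x) c := by
  have h1 := frame_inverse hE hx (frameVec (S.G x) c)
  have h2 := metric_frame hx ((S.frame x).inverse (frameVec (S.G x) c))
  rw [h1, frameCoeff_frameVec, (metric_N_eq_zero hx c).2 hc] at h2
  rw [frame_apply, ← h2, zero_smul, add_zero] at h1
  exact h1

/-- Adding the normal direction makes the differential invertible. Preimages of tangent vectors are
thus smooth in the base point because inversion of continuous linear equivalences is smooth. -/
theorem contDiffOn_inverse {c : E → Heis n} (hc : ContDiffOn ℝ ∞ c S.W) :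
    ContDiffOn ℝ ∞ (fun x => ((S.frame x).inverse (frameVec (S.G x) (c x))).1) S.W := by
  have h1 : ContDiffOn ℝ ∞ S.frame S.W :=
    (((S.contDiffOn_G.fderiv_of_isOpen S.isOpen (by simp)).clm_comp contDiffOn_const).add
      (contDiffOn_const.smulRight (S.contDiffOn_G.frameVec S.contDiffOn_N)))
  have h2 : ContDiffOn ℝ ∞ (fun x => (S.frame x).inverse) S.W := by
    intro x hx
    obtain ⟨e, he⟩ := exists_equiv hE hx
    have h3 := contDiffAt_map_inverse (n := ∞) e
    rw [he] at h3
    exact h3.comp_contDiffWithinAt x (h1 x hx)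
  exact (h2.clm_apply (S.contDiffOn_G.frameVec hc)).fst

end

variable (S)

/-- The tangent vector of the projection of the horizontal vector `a` to the hypersurface. -/
noncomputable def horLift (x : E) : Hor n →ₗ[ℝ] E where
  toFun a := ((S.frame x).inverse (frameVec (S.G x) (a - inner ℝ a (S.ν x) • S.ν x, 0))).1
  map_add' a b := by
    rw [← Prod.fst_add, ← map_add, ← frameVec_add, Prod.mk_add_mk, add_zero, inner_add_left,
      add_smul]
    congr 5
    abel
  map_smul' r a := by
    rw [RingHom.id_apply, ← Prod.smul_fst, ← map_smul, ← frameVec_smul, Prod.smul_mk, smul_zero,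
      inner_smul_left, smul_sub, mul_smul]
    rfl

/-- The tangent vector field `T - α ν`. -/
noncomputable def vertField (x : E) : E :=
  ((S.frame x).inverse (frameVec (S.G x) (-(S.α x • S.ν x), 1))).1

variable {S}

theorem horLift_apply (a : Hor n) : S.horLift x a =
    ((S.frame x).inverse (frameVec (S.G x) (a - inner ℝ a (S.ν x) • S.ν x, 0))).1 := rfl

theorem horLift_ν (hx : x ∈ S.W) : S.horLift x (S.ν x) = 0 := by
  have : frameVec (S.G x) (0, 0) = 0 := by
    have hJ : J (0 : Hor n) = 0 := (JL (n := n)).map_zero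
    rw [frameVec_eq, hJ, inner_zero_left, add_zero]
    rfl
  rw [horLift_apply, inner_ν_ν hx, one_smul, sub_self, this]
  simp

theorem horLift_eq_sum (a : Hor n) :
    S.horLift x a = ∑ i, a i • S.horLift x (EuclideanSpace.single i 1) := by
  conv_lhs => rw [← (EuclideanSpace.basisFun (Fin n ⊕ Fin n) ℝ).sum_repr a]
  simp

section

variable [FiniteDimensional ℝ E] (hE : Module.finrank ℝ E = 2 * n)
include hE

theorem fderiv_horLift (hx : x ∈ S.W) (a : Hor n) :
    fderiv ℝ S.G x (S.horLift x a) = frameVec (S.G x) (a - inner ℝ a (S.ν x) • S.ν x, 0) := by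
  rw [horLift_apply, fderiv_inverse hE hx]
  rw [inner_sub_left, inner_smul_left, inner_ν_ν hx]
  simp

theorem fderiv_vertField (hx : x ∈ S.W) :
    fderiv ℝ S.G x (S.vertField x) = frameVec (S.G x) (-(S.α x • S.ν x), 1) := by
  rw [vertField, fderiv_inverse hE hx]
  rw [inner_neg_left, inner_smul_left, inner_ν_ν hx]
  simp

theorem contDiffOn_horLift (a : Hor n) : ContDiffOn ℝ ∞ (fun x => S.horLift x a) S.W :=
  contDiffOn_inverse hE ((contDiffOn_const.sub
    ((contDiffOn_const.inner ℝ S.contDiffOn_ν).smul S.contDiffOn_ν)).prodMk contDiffOn_const)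

theorem contDiffOn_vertField : ContDiffOn ℝ ∞ S.vertField S.W :=
  contDiffOn_inverse hE ((S.contDiffOn_α.smul S.contDiffOn_ν).neg.prodMk contDiffOn_const)

/-- The tangent vectors of the hypersurface in terms of `horLift` and `vertField`. -/
theorem eq_horLift_add (hx : x ∈ S.W) {v : E} {c : Heis n}
    (hc : fderiv ℝ S.G x v = frameVec (S.G x) c) :
    inner ℝ c.1 (S.ν x) = -(S.α x * c.2) ∧ v = S.horLift x c.1 + c.2 • S.vertField x := by
  have h1 : inner ℝ c.1 (S.ν x) = -(S.α x * c.2) := by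
    rw [← metric_N_eq_zero hx, ← frameCoeff_frameVec (S.G x) c, ← hc, S.normal x hx]
  refine ⟨h1, S.injective x hx ?_⟩
  rw [map_add, map_smul, fderiv_horLift hE hx, fderiv_vertField hE hx, ← frameVec_smul,
    ← frameVec_add, hc, h1]
  congr 1
  refine Prod.ext ?_ ?_
  · simp only [Prod.fst_add, Prod.smul_fst]
    module
  · simp

end

/-- The Lie bracket of two tangent vector fields, in terms of their coefficients in the
left-invariant frame. -/
theorem fderiv_lieBracket (hx : x ∈ S.W) {U V : E → E} {c d : E → Heis n}
    (hU : DifferentiableAt ℝ U x) (hV : DifferentiableAt ℝ V x)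
    (hc : DifferentiableAt ℝ c x) (hd : DifferentiableAt ℝ d x)
    (hUc : ∀ y ∈ S.W, fderiv ℝ S.G y (U y) = frameVec (S.G y) (c y))
    (hVd : ∀ y ∈ S.W, fderiv ℝ S.G y (V y) = frameVec (S.G y) (d y)) :
    fderiv ℝ S.G x (VectorField.lieBracket ℝ U V x) =
      frameVec (S.G x) (fderiv ℝ d x (U x) - fderiv ℝ c x (V x)
        + (0, -2 * inner ℝ (J (c x).1) (d x).1)) := by
  have hG := S.contDiffOn_G.contDiffAt (S.isOpen.mem_nhds hx)
  have hG1 : DifferentiableAt ℝ S.G x := hG.differentiableAt (by simp)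
  have e1 : (fun y => fderiv ℝ S.G y (U y)) =ᶠ[nhds x] fun y => frameVec (S.G y) (c y) := by
    filter_upwards [S.isOpen.mem_nhds hx] with y hy using hUc y hy
  have e2 : (fun y => fderiv ℝ S.G y (V y)) =ᶠ[nhds x] fun y => frameVec (S.G y) (d y) := by
    filter_upwards [S.isOpen.mem_nhds hx] with y hy using hVd y hy
  rw [← fderiv_fderiv_apply_sub hG hU hV, e1.fderiv_eq, e2.fderiv_eq, fderiv_frameVec hG1 hc,
    fderiv_frameVec hG1 hd, hUc x hx, hVd x hx, ← frameVec_add_vertical, frameVec_sub]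
  -- Differentiating the frame itself contributes `⟨J d, c⟩ - ⟨J c, d⟩`; by skewness of `J` this is
  -- the torsion term `-2⟨J c, d⟩`.
  have : inner ℝ (J (d x).1) (c x).1 = -inner ℝ (J (c x).1) (d x).1 := by
    rw [inner_J_left, real_inner_comm]
  simp only [frameVec_eq, this]
  refine Prod.ext ?_ ?_
  · simp
  · simp
    ring

end LocalHypersurface

end Heisenberg

/-! ### Lie brackets and the structure equations of a hypersurface -/

namespace Heisenberg

namespace LocalHypersurface

open smoothFunctions

variable {n : ℕ} {E : Type*} [NormedAddCommGroup E] [NormedSpace ℝ E]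
  {S : LocalHypersurface n E} {x : E}

variable (S) in
/-- The `i`-th vector of the left-invariant horizontal frame, projected to the hypersurface. -/
noncomputable def horField (i : Fin n ⊕ Fin n) (x : E) : E :=
  S.horLift x (EuclideanSpace.single i 1)

theorem differentiableAt_ν (hx : x ∈ S.W) : DifferentiableAt ℝ S.ν x :=
  (S.contDiffOn_ν.contDiffAt (S.isOpen.mem_nhds hx)).differentiableAt (by simp)

theorem differentiableAt_α (hx : x ∈ S.W) : DifferentiableAt ℝ S.α x :=
  (S.contDiffOn_α.contDiffAt (S.isOpen.mem_nhds hx)).differentiableAt (by simp)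

theorem inner_fderiv_ν (hx : x ∈ S.W) (v : E) : inner ℝ (fderiv ℝ S.ν x v) (S.ν x) = 0 := by
  have h1 : (fun y => inner ℝ (S.ν y) (S.ν y)) =ᶠ[nhds x] fun _ => (1 : ℝ) := by
    filter_upwards [S.isOpen.mem_nhds hx] with y hy using inner_ν_ν hy
  have h2 := congrArg (fun L : E →L[ℝ] ℝ => L v) h1.fderiv_eq
  simp only [fderiv_inner_apply ℝ (differentiableAt_ν hx) (differentiableAt_ν hx),
    fderiv_const_apply, zero_apply] at h2
  rw [real_inner_comm] at h2
  linarith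

theorem contDiffOn_ν_apply (i : Fin n ⊕ Fin n) : ContDiffOn ℝ ∞ (fun x => S.ν x i) S.W :=
  (EuclideanSpace.proj i : Hor n →L[ℝ] ℝ).contDiff.comp_contDiffOn S.contDiffOn_ν

theorem fderiv_ν_apply (hx : x ∈ S.W) (v : E) (i : Fin n ⊕ Fin n) :
    fderiv ℝ (fun y => S.ν y i) x v = fderiv ℝ S.ν x v i := by
  have h := (EuclideanSpace.proj i : Hor n →L[ℝ] ℝ).hasFDerivAt.comp x
    (differentiableAt_ν hx).hasFDerivAt
  have h' : HasFDerivAt (fun y => S.ν y i)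
    ((EuclideanSpace.proj i : Hor n →L[ℝ] ℝ).comp (fderiv ℝ S.ν x)) x := h
  rw [h'.fderiv]
  rfl

/-- The coefficients in the left-invariant frame of `horField`. -/
noncomputable def horCoeff (S : LocalHypersurface n E) (i : Fin n ⊕ Fin n) (x : E) : Heis n :=
  (EuclideanSpace.single i 1 - S.ν x i • S.ν x, 0)

/-- The coefficients in the left-invariant frame of `vertField`. -/
noncomputable def vertCoeff (S : LocalHypersurface n E) (x : E) : Heis n :=
  (-(S.α x • S.ν x), 1)

theorem hasFDerivAt_horCoeff (hx : x ∈ S.W) (i : Fin n ⊕ Fin n) :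
    DifferentiableAt ℝ (S.horCoeff i) x ∧ ∀ v, fderiv ℝ (S.horCoeff i) x v =
      (-(S.ν x i • fderiv ℝ S.ν x v + fderiv ℝ S.ν x v i • S.ν x), 0) := by
  have h1 : DifferentiableAt ℝ (fun y => S.ν y i) x :=
    ((S.contDiffOn_ν_apply i).contDiffAt (S.isOpen.mem_nhds hx)).differentiableAt (by simp)
  have h2 := ((h1.hasFDerivAt.smul (differentiableAt_ν hx).hasFDerivAt).const_sub
    (EuclideanSpace.single i (1 : ℝ))).prodMk (hasFDerivAt_const (0 : ℝ) x)
  have h3 : HasFDerivAt (S.horCoeff i) _ x := h2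
  refine ⟨h3.differentiableAt, fun v => ?_⟩
  rw [h3.fderiv]
  simp [fderiv_ν_apply hx]

theorem hasFDerivAt_vertCoeff (hx : x ∈ S.W) :
    DifferentiableAt ℝ S.vertCoeff x ∧ ∀ v, fderiv ℝ S.vertCoeff x v =
      (-(S.α x • fderiv ℝ S.ν x v + fderiv ℝ S.α x v • S.ν x), 0) := by
  have h2 := (((differentiableAt_α hx).hasFDerivAt.smul
    (differentiableAt_ν hx).hasFDerivAt).neg).prodMk (hasFDerivAt_const (1 : ℝ) x)
  have h3 : HasFDerivAt S.vertCoeff _ x := h2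
  refine ⟨h3.differentiableAt, fun v => ?_⟩
  rw [h3.fderiv]
  simp

section

variable [FiniteDimensional ℝ E] (hE : Module.finrank ℝ E = 2 * n)
include hE

theorem contDiffOn_horField (i : Fin n ⊕ Fin n) : ContDiffOn ℝ ∞ (S.horField i) S.W :=
  contDiffOn_horLift hE _

theorem fderiv_horField (i : Fin n ⊕ Fin n) {y : E} (hy : y ∈ S.W) :
    fderiv ℝ S.G y (S.horField i y) = frameVec (S.G y) (S.horCoeff i y) := by
  rw [horField, fderiv_horLift hE hy, EuclideanSpace.inner_single_left]
  simp [horCoeff]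

theorem differentiableAt_horField (hx : x ∈ S.W) (i : Fin n ⊕ Fin n) :
    DifferentiableAt ℝ (S.horField i) x :=
  ((contDiffOn_horField hE i).contDiffAt (S.isOpen.mem_nhds hx)).differentiableAt (by simp)

theorem differentiableAt_vertField (hx : x ∈ S.W) : DifferentiableAt ℝ S.vertField x :=
  ((contDiffOn_vertField hE).contDiffAt (S.isOpen.mem_nhds hx)).differentiableAt (by simp)

end

theorem J_single_apply (a b : Fin n ⊕ Fin n) :
    J (EuclideanSpace.single a (1 : ℝ)) b = -J (EuclideanSpace.single b (1 : ℝ)) a := by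
  have := inner_J_left (EuclideanSpace.single a (1 : ℝ)) (EuclideanSpace.single b (1 : ℝ))
  rw [EuclideanSpace.inner_single_right, EuclideanSpace.inner_single_left] at this
  simpa using this

theorem J_apply_eq_sum (v : Hor n) (a : Fin n ⊕ Fin n) :
    J v a = ∑ b, J (EuclideanSpace.single b (1 : ℝ)) a * v b := by
  have h : JL v = _ := congrArg JL ((EuclideanSpace.basisFun (Fin n ⊕ Fin n) ℝ).sum_repr v).symm
  rw [JL_apply] at h
  rw [h, map_sum]
  simp [mul_comm]

theorem horField_eq_sum (hx : x ∈ S.W) : ∑ i, S.ν x i • S.horField i x = 0 := by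
  rw [← horLift_ν hx, horLift_eq_sum]
  rfl

variable (S)

/-- The calculus of horizontal tangential derivatives on a hypersurface. -/
noncomputable def calculus [FiniteDimensional ℝ E] (hE : Module.finrank ℝ E = 2 * n) :
    HorizontalCalculus (Fin n ⊕ Fin n) (smoothFunctions S.W) where
  D i := derivation S.isOpen (S.horField i) (contDiffOn_horField hE i)
  T := derivation S.isOpen S.vertField (contDiffOn_vertField hE)
  J := Matrix.of fun a b => algebraMap ℝ _ (J (EuclideanSpace.single b (1 : ℝ)) a)
  ν i := restrict _ (S.contDiffOn_ν_apply i)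
  α := restrict _ S.contDiffOn_α
  J_transpose := by
    ext1 a b
    rw [Matrix.transpose_apply, Matrix.neg_apply, Matrix.of_apply, Matrix.of_apply,
      J_single_apply, map_neg]
  J_mul_J := by
    ext1 a b
    simp only [Matrix.mul_apply, Matrix.of_apply, ← map_mul, ← map_sum, Matrix.neg_apply,
      Matrix.one_apply]
    rw [← J_apply_eq_sum, J_J]
    by_cases h : a = b <;> simp [h]
  D_J i a b := by
    rw [Matrix.of_apply, Derivation.map_algebraMap]
  norm_ν := by
    refine ext_eval fun x hx => ?_
    have h := inner_ν_ν hx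
    simp only [PiLp.inner_apply, RCLike.inner_apply, conj_trivial] at h
    rw [dotProduct, eval_sum, eval_one hx, ← h]
    simp only [eval_mul, eval_restrict _ hx]
  D_ν f := by
    refine ext_eval fun x hx => ?_
    rw [eval_sum, eval_zero]
    have h := congrArg (fderiv ℝ (eval f) x) (horField_eq_sum hx)
    simp only [map_sum, map_smul, smul_eq_mul, map_zero] at h
    simp only [eval_mul, eval_restrict _ hx, eval_derivation _ _ _ hx, h]

variable {S} [FiniteDimensional ℝ E] {hE : Module.finrank ℝ E = 2 * n}

theorem eval_D (hx : x ∈ S.W) (i : Fin n ⊕ Fin n) (f : smoothFunctions S.W) :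
    eval ((S.calculus hE).D i f) x = fderiv ℝ (eval f) x (S.horField i x) :=
  eval_derivation S.isOpen (contDiffOn_horField hE i) f hx

theorem eval_T (hx : x ∈ S.W) (f : smoothFunctions S.W) :
    eval ((S.calculus hE).T f) x = fderiv ℝ (eval f) x (S.vertField x) :=
  eval_derivation S.isOpen (contDiffOn_vertField hE) f hx

theorem eval_ν (hx : x ∈ S.W) (i : Fin n ⊕ Fin n) :
    eval ((S.calculus hE).ν i) x = S.ν x i :=
  eval_restrict (S.contDiffOn_ν_apply i) hx

theorem eval_α (hx : x ∈ S.W) : eval (S.calculus hE).α x = S.α x :=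
  eval_restrict S.contDiffOn_α hx

theorem eval_J (hx : x ∈ S.W) (a b : Fin n ⊕ Fin n) :
    eval ((S.calculus hE).J a b) x = J (EuclideanSpace.single b (1 : ℝ)) a :=
  eval_algebraMap _ hx

theorem eval_e (hx : x ∈ S.W) (i : Fin n ⊕ Fin n) :
    eval ((S.calculus hE).e i) x = J (S.ν x) i := by
  rw [J_apply_eq_sum, HorizontalCalculus.e, Matrix.mulVec, dotProduct, eval_sum]
  refine Finset.sum_congr rfl fun b _ => ?_
  rw [eval_mul, eval_ν hx, eval_J hx]

theorem eval_K (hx : x ∈ S.W) (a b : Fin n ⊕ Fin n) :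
    eval ((S.calculus hE).K a b) x = J (EuclideanSpace.single b (1 : ℝ)) a
      - J (S.ν x) a * S.ν x b + S.ν x a * J (S.ν x) b := by
  rw [HorizontalCalculus.K_apply, eval_add, eval_sub, eval_mul, eval_mul, eval_ν hx, eval_ν hx,
    eval_e hx, eval_e hx, eval_J hx]

theorem eval_D_ν (hx : x ∈ S.W) (a b : Fin n ⊕ Fin n) :
    eval ((S.calculus hE).D b ((S.calculus hE).ν a)) x = fderiv ℝ S.ν x (S.horField b x) a := by
  rw [← fderiv_ν_apply hx]
  exact eval_derivation_restrict S.isOpen (contDiffOn_horField hE b) (S.contDiffOn_ν_apply a) hx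

theorem eval_A (hx : x ∈ S.W) (a b : Fin n ⊕ Fin n) :
    eval ((S.calculus hE).A a b) x = fderiv ℝ S.ν x (S.horField b x) a := eval_D_ν hx a b

theorem eval_T_ν (hx : x ∈ S.W) (a : Fin n ⊕ Fin n) :
    eval ((S.calculus hE).T ((S.calculus hE).ν a)) x = fderiv ℝ S.ν x (S.vertField x) a := by
  rw [← fderiv_ν_apply hx]
  exact eval_derivation_restrict S.isOpen (contDiffOn_vertField hE) (S.contDiffOn_ν_apply a) hx

theorem eval_D_α (hx : x ∈ S.W) (i : Fin n ⊕ Fin n) :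
    eval ((S.calculus hE).D i (S.calculus hE).α) x = fderiv ℝ S.α x (S.horField i x) :=
  eval_derivation_restrict S.isOpen (contDiffOn_horField hE i) S.contDiffOn_α hx

theorem eval_lam (hx : x ∈ S.W) :
    eval (S.calculus hE).lam x = fderiv ℝ S.α x (S.horLift x (J (S.ν x))) := by
  rw [HorizontalCalculus.lam, eval_sum, horLift_eq_sum]
  simp only [eval_mul, eval_e hx, eval_D_α hx, map_sum, map_smul, smul_eq_mul, horField]

omit [FiniteDimensional ℝ E] in
theorem fderiv_comm (hx : x ∈ S.W) {U V : E → E} (hU : ContDiffOn ℝ ∞ U S.W)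
    (hV : ContDiffOn ℝ ∞ V S.W) (f : smoothFunctions S.W) :
    eval (derivation S.isOpen U hU (derivation S.isOpen V hV f)) x
      - eval (derivation S.isOpen V hV (derivation S.isOpen U hU f)) x
      = fderiv ℝ (eval f) x (VectorField.lieBracket ℝ U V x) := by
  have hN := S.isOpen.mem_nhds hx
  rw [← fderiv_fderiv_apply_sub ((contDiffOn_eval f).contDiffAt hN)
    ((hU.contDiffAt hN).differentiableAt (by simp))
    ((hV.contDiffAt hN).differentiableAt (by simp)), eval_derivation _ _ _ hx,
    eval_derivation _ _ _ hx]
  congr 1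
  · refine congrArg (fun L : E →L[ℝ] ℝ => L (U x)) (Filter.EventuallyEq.fderiv_eq ?_)
    filter_upwards [hN] with y hy using eval_derivation _ _ _ hy
  · refine congrArg (fun L : E →L[ℝ] ℝ => L (V x)) (Filter.EventuallyEq.fderiv_eq ?_)
    filter_upwards [hN] with y hy using eval_derivation _ _ _ hy

/-- Both parts come from the frame coefficients of the bracket. It is tangent, and pairing with `ν`
compares its horizontal part with its `T` component, which is the antisymmetry defect of the shape
operator. Expanding it in the spanning fields then gives the bracket, where multiples of `ν` have
zero lift. -/
theorem lieBracket_horField (hE : Module.finrank ℝ E = 2 * n) (hx : x ∈ S.W)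
    (a b : Fin n ⊕ Fin n) :
    fderiv ℝ S.ν x (S.horField b x) a - fderiv ℝ S.ν x (S.horField a x) b =
      2 * S.α x * (J (EuclideanSpace.single a (1 : ℝ)) b - J (S.ν x) b * S.ν x a
        + S.ν x b * J (S.ν x) a) ∧
    VectorField.lieBracket ℝ (S.horField a) (S.horField b) x =
      S.horLift x (S.ν x a • fderiv ℝ S.ν x (S.horField b x)
        - S.ν x b • fderiv ℝ S.ν x (S.horField a x))
      - (2 * (J (EuclideanSpace.single a (1 : ℝ)) b - J (S.ν x) b * S.ν x a
        + S.ν x b * J (S.ν x) a)) • S.vertField x := by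
  obtain ⟨da, ha⟩ := hasFDerivAt_horCoeff hx a
  obtain ⟨db, hb⟩ := hasFDerivAt_horCoeff hx b
  have h := fderiv_lieBracket hx (differentiableAt_horField hE hx a)
    (differentiableAt_horField hE hx b) da db (fun y hy => fderiv_horField hE a hy)
    (fun y hy => fderiv_horField hE b hy)
  have hJ : inner ℝ (J (S.horCoeff a x).1) (S.horCoeff b x).1 =
      J (EuclideanSpace.single a (1 : ℝ)) b - J (S.ν x) b * S.ν x a + S.ν x b * J (S.ν x) a := by
    have h1 : inner ℝ (J (EuclideanSpace.single a (1 : ℝ))) (S.ν x) = -J (S.ν x) a := by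
      rw [inner_J_left, EuclideanSpace.inner_single_left]; simp
    simp only [horCoeff, J_sub, J_smul, inner_sub_left, inner_sub_right, inner_smul_left,
      inner_smul_right, EuclideanSpace.inner_single_right, inner_J_self, h1]
    simp
    ring
  rw [ha, hb, hJ] at h
  obtain ⟨h1, h2⟩ := eq_horLift_add hE hx h
  constructor
  · have hν := inner_ν_ν (S := S) hx
    simp only [Prod.fst_add, Prod.fst_sub, Prod.snd_add, Prod.snd_sub, inner_add_left,
      inner_sub_left, inner_neg_left, inner_smul_left, inner_fderiv_ν hx, hν] at h1
    simp at h1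
    linarith
  · rw [h2]
    have h3 : S.horLift x (S.ν x) = 0 := horLift_ν hx
    simp only [Prod.fst_add, Prod.fst_sub, Prod.snd_add, Prod.snd_sub, map_add, map_sub, map_neg,
      map_smul, h3]
    simp
    module

/-- The same mechanism with `T - αν` as second field: the tangency condition now determines the
derivative of `ν` along `T - αν`. -/
theorem lieBracket_vertField (hE : Module.finrank ℝ E = 2 * n) (hx : x ∈ S.W)
    (a : Fin n ⊕ Fin n) :
    fderiv ℝ S.ν x (S.vertField x) a =
      fderiv ℝ S.α x (S.horField a x) + 2 * S.α x ^ 2 * J (S.ν x) a ∧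
    VectorField.lieBracket ℝ (S.horField a) S.vertField x =
      S.horLift x (S.ν x a • fderiv ℝ S.ν x (S.vertField x)
        - S.α x • fderiv ℝ S.ν x (S.horField a x))
      - (2 * S.α x * J (S.ν x) a) • S.vertField x := by
  obtain ⟨da, ha⟩ := hasFDerivAt_horCoeff hx a
  obtain ⟨db, hb⟩ := hasFDerivAt_vertCoeff hx
  have h := fderiv_lieBracket hx (differentiableAt_horField hE hx a)
    (differentiableAt_vertField hE hx) da db (fun y hy => fderiv_horField hE a hy)
    (fun y hy => fderiv_vertField hE hy)
  have hJ : inner ℝ (J (S.horCoeff a x).1) (S.vertCoeff x).1 = S.α x * J (S.ν x) a := by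
    have h1 : inner ℝ (J (EuclideanSpace.single a (1 : ℝ))) (S.ν x) = -J (S.ν x) a := by
      rw [inner_J_left, EuclideanSpace.inner_single_left]; simp
    simp only [horCoeff, vertCoeff, J_sub, J_smul, inner_sub_left, inner_neg_right,
      inner_smul_left, inner_smul_right, inner_J_self, h1]
    simp
  rw [ha, hb, hJ] at h
  obtain ⟨h1, h2⟩ := eq_horLift_add hE hx h
  constructor
  · have hν := inner_ν_ν (S := S) hx
    simp only [Prod.fst_add, Prod.fst_sub, Prod.snd_add, Prod.snd_sub, inner_add_left,
      inner_sub_left, inner_neg_left, inner_smul_left, inner_fderiv_ν hx, hν] at h1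
    simp at h1
    linarith
  · rw [h2]
    have h3 : S.horLift x (S.ν x) = 0 := horLift_ν hx
    simp only [Prod.fst_add, Prod.fst_sub, Prod.snd_add, Prod.snd_sub, map_add, map_sub, map_neg,
      map_smul, h3]
    simp
    module

/-- The structure equations of a minimal hypersurface with property (P2). -/
theorem structureEquations (hE : Module.finrank ℝ E = 2 * n)
    (hmin : ∀ x ∈ S.W, ∑ i, fderiv ℝ S.ν x (S.horField i x) i = 0)
    (hP2 : ∀ x ∈ S.W, ∀ i, fderiv ℝ S.α x (S.horField i x) =
      fderiv ℝ S.α x (S.horLift x (J (S.ν x))) * J (S.ν x) i) :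
    (S.calculus hE).StructureEquations where
  comm_D a b f := by
    refine ext_eval fun x hx => ?_
    rw [eval_sub, eval_sub]
    have h := fderiv_comm hx (contDiffOn_horField hE a) (contDiffOn_horField hE b) f
    rw [(lieBracket_horField hE hx a b).2, horLift_eq_sum] at h
    simp only [map_sub, map_sum, map_smul, smul_eq_mul] at h
    rw [eval_sum]
    simp only [eval_mul, eval_sub, eval_ν hx, eval_A hx, eval_K hx, eval_two hx, eval_T hx,
      eval_D hx _ f]
    refine h.trans ?_
    congr 1
  comm_T a f := by
    refine ext_eval fun x hx => ?_
    rw [eval_sub, eval_sub]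
    have h := fderiv_comm hx (contDiffOn_horField hE a) (contDiffOn_vertField hE) f
    rw [(lieBracket_vertField hE hx a).2, horLift_eq_sum] at h
    simp only [map_sub, map_sum, map_smul, smul_eq_mul] at h
    rw [eval_sum]
    simp only [eval_mul, eval_add, eval_neg, eval_ν hx, eval_A hx, eval_e hx, eval_α hx,
      eval_two hx, eval_T hx f, eval_T_ν hx, eval_D hx _ f]
    refine h.trans ?_
    congr 1
    refine Finset.sum_congr rfl fun c _ => ?_
    simp only [PiLp.sub_apply, PiLp.smul_apply, smul_eq_mul, horField]
    ring
  A_sub a b := by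
    refine ext_eval fun x hx => ?_
    simp only [eval_mul, eval_sub, eval_neg, eval_A hx, eval_K hx, eval_two hx, eval_α hx]
    rw [(lieBracket_horField hE hx a b).1, J_single_apply a b]
    ring
  T_ν c := by
    refine ext_eval fun x hx => ?_
    rw [eval_T_ν hx, eval_add, eval_mul, eval_mul, eval_pow _ _ hx, eval_two hx, eval_α hx,
      eval_e hx, eval_D_α hx, (lieBracket_vertField hE hx c).1]
  D_α c := by
    refine ext_eval fun x hx => ?_
    rw [eval_D_α hx, eval_mul, eval_lam hx, eval_e hx, hP2 x hx]
  trace_A := by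
    refine ext_eval fun x hx => ?_
    rw [Matrix.trace, eval_sum, eval_zero, ← hmin x hx]
    exact Finset.sum_congr rfl fun i _ => eval_A hx i i

end LocalHypersurface

end Heisenberg

namespace Heisenberg

variable {n : ℕ} {M : Type*} [TopologicalSpace M]
  [ChartedSpace (EuclideanSpace ℝ (Fin (2 * n))) M] {F : M → Heis n} {U : Set M} {N : M → Heis n}

/-! ### Characteristic points -/

/-- If the tangent space were horizontal, it would contain the horizontal part of `N`, whose product
with `N` is its own squared length. -/
theorem not_isCharacteristic (hN : IsUnitNormalOn F U N) {p : M} (hp : p ∈ U)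
    (h : (N p).1 ≠ 0) : ¬ IsCharacteristic F p := by
  intro hc
  have hmem : frameVec (F p) ((N p).1, 0) ∈ horizontalSpace (F p) := by
    rw [horizontalSpace, Set.mem_ofPred_eq, frameCoeff_frameVec]
  rw [← hc] at hmem
  obtain ⟨v, hv⟩ := hmem
  have h1 := hN.normal p hp v
  rw [hv, frameCoeff_frameVec, metric] at h1
  simp only [mul_zero, add_zero, inner_self_eq_zero] at h1
  exact h h1

/-- If `N` is vertical, every tangent vector is horizontal. Equality with the horizontal space
follows by dimension: horizontal vectors are determined by their first component, and both spaces
have dimension `2n`. -/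
theorem horizontal_ne_zero (hF : IsImmersedHypersurface F) (hN : IsUnitNormalOn F U N) {p : M}
    (hp : p ∈ U) (hc : ¬ IsCharacteristic F p) : (N p).1 ≠ 0 := by
  intro h0
  have h2 : (N p).2 ≠ 0 := by
    intro h3
    have := hN.unit p hp
    rw [metric, h0, h3] at this
    simp at this
  have h3 : ∀ v, (frameCoeff (F p) (tangentMap F p v)).2 = 0 := by
    intro v
    have := hN.normal p hp v
    rw [metric, h0, inner_zero_left, zero_add] at this
    exact (mul_eq_zero.1 this).resolve_left h2
  have h4 : ∀ w w' : Heis n, w.1 = w'.1 → (frameCoeff (F p) w).2 = (frameCoeff (F p) w').2 →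
      w = w' := by
    intro w w' h5 h6
    rw [← frameVec_frameCoeff (F p) w, ← frameVec_frameCoeff (F p) w']
    congr 1
    exact Prod.ext h5 h6
  let D : EuclideanSpace ℝ (Fin (2 * n)) →L[ℝ] Heis n := tangentMap F p
  let L : EuclideanSpace ℝ (Fin (2 * n)) →ₗ[ℝ] Hor n :=
    (LinearMap.fst ℝ (Hor n) ℝ).comp D.toLinearMap
  have hL : Function.Injective L := by
    intro v w hvw
    exact hF.injective p (h4 _ _ hvw ((h3 v).trans (h3 w).symm))
  have hd : Module.finrank ℝ (EuclideanSpace ℝ (Fin (2 * n))) = Module.finrank ℝ (Hor n) := by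
    simp; ring
  have hs : Function.Surjective L :=
    (LinearMap.injective_iff_surjective_of_finrank_eq_finrank hd).1 hL
  refine hc (Set.Subset.antisymm ?_ ?_)
  · rintro _ ⟨v, rfl⟩
    exact h3 v
  · intro w hw
    obtain ⟨v, hv⟩ := hs w.1
    exact ⟨v, h4 _ _ hv ((h3 v).trans hw.symm)⟩

/-! ### The hypersurface in a chart -/

variable [IsManifold (𝓡 (2 * n)) ∞ M]

/-- The non-characteristic part of the hypersurface in a chart. -/
noncomputable def chartHypersurface (hF : IsImmersedHypersurface F) (hU : IsOpen U)
    (hN : IsUnitNormalOn F U N) (p : M) :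
    LocalHypersurface n (EuclideanSpace ℝ (Fin (2 * n))) where
  W := (chartAt (EuclideanSpace ℝ (Fin (2 * n))) p).target ∩
    (chartAt (EuclideanSpace ℝ (Fin (2 * n))) p).symm ⁻¹' {q ∈ U | (N q).1 ≠ 0}
  G := F ∘ (chartAt (EuclideanSpace ℝ (Fin (2 * n))) p).symm
  N := N ∘ (chartAt (EuclideanSpace ℝ (Fin (2 * n))) p).symm
  isOpen := by
    refine OpenPartialHomeomorph.isOpen_inter_preimage_symm _ ?_
    exact (hN.smooth.continuousOn.fst).isOpen_inter_preimage hU isOpen_compl_singleton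
  contDiffOn_G := by
    rw [← contMDiffOn_iff_contDiffOn]
    exact hF.smooth.comp_contMDiffOn
      ((contMDiffOn_chart_symm (I := 𝓡 (2 * n)) (x := p)).mono Set.inter_subset_left)
  contDiffOn_N := by
    rw [← contMDiffOn_iff_contDiffOn]
    exact hN.smooth.comp
      ((contMDiffOn_chart_symm (I := 𝓡 (2 * n)) (x := p)).mono Set.inter_subset_left)
      fun x hx => hx.2.1
  injective := by
    rintro x ⟨hx, hxU⟩
    have hd := mdifferentiable_chart (I := 𝓡 (2 * n)) p
    have h1 := mfderiv_comp x ((hF.smooth _).mdifferentiableAt (by simp))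
      (hd.mdifferentiableAt_symm hx)
    rw [mfderiv_eq_fderiv] at h1
    rw [h1]
    refine (hF.injective _).comp ?_
    have h2 := hd.comp_symm_deriv hx
    intro v w hvw
    have h3 := congrArg (mfderiv (𝓡 (2 * n)) (𝓡 (2 * n))
      (chartAt (EuclideanSpace ℝ (Fin (2 * n))) p) ((chartAt _ p).symm x)) hvw
    have h4 : ∀ u, mfderiv (𝓡 (2 * n)) (𝓡 (2 * n))
      (chartAt (EuclideanSpace ℝ (Fin (2 * n))) p) ((chartAt _ p).symm x)
      (mfderiv (𝓡 (2 * n)) (𝓡 (2 * n)) (chartAt _ p).symm x u) = u :=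
      fun u => DFunLike.congr_fun h2 u
    exact (h4 v).symm.trans (h3.trans (h4 w))
  unit := fun x hx => hN.unit _ hx.2.1
  normal := by
    rintro x ⟨hx, hxU⟩ v
    have hd := mdifferentiable_chart (I := 𝓡 (2 * n)) p
    have h1 := mfderiv_comp x ((hF.smooth _).mdifferentiableAt (by simp))
      (hd.mdifferentiableAt_symm hx)
    rw [mfderiv_eq_fderiv] at h1
    rw [h1]
    exact hN.normal _ hxU.1 _
  horizontal_ne_zero := fun x hx => hx.2.2

end Heisenberg

/-! ### Transfer of derivatives and of h̃ to a chart -/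

namespace Heisenberg

open smoothFunctions LocalHypersurface

variable {n : ℕ} {M : Type*} [TopologicalSpace M]
  [ChartedSpace (EuclideanSpace ℝ (Fin (2 * n))) M] [IsManifold (𝓡 (2 * n)) ∞ M]
  {F : M → Heis n} {U : Set M} {N : M → Heis n} (hF : IsImmersedHypersurface F) (hU : IsOpen U)
  (hN : IsUnitNormalOn F U N) (p : M)

/-- The set of non-characteristic points in the domain of a chart. -/
def chartDomain (U : Set M) (N : M → Heis n) (p : M) : Set M :=
  {q | q ∈ (chartAt (EuclideanSpace ℝ (Fin (2 * n))) p).source ∧ q ∈ U ∧ (N q).1 ≠ 0}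

variable {p} {q : M}

theorem chart_mem (hq : q ∈ chartDomain U N p) :
    chartAt (EuclideanSpace ℝ (Fin (2 * n))) p q ∈ (chartHypersurface hF hU hN p).W := by
  refine ⟨OpenPartialHomeomorph.map_source _ hq.1, ?_⟩
  rw [Set.mem_preimage, OpenPartialHomeomorph.left_inv _ hq.1]
  exact hq.2

omit [IsManifold (𝓡 (2 * n)) ∞ M] in
theorem chartDomain_mem_nhds (hU : IsOpen U) (hN : IsUnitNormalOn F U N)
    (hq : q ∈ chartDomain U N p) : chartDomain U N p ∈ nhds q := by
  have h1 : IsOpen {q ∈ U | (N q).1 ≠ 0} :=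
    (hN.smooth.continuousOn.fst).isOpen_inter_preimage hU isOpen_compl_singleton
  exact ((chartAt _ p).open_source.inter h1).mem_nhds hq

theorem nu_eq (hq : q ∈ chartDomain U N p) :
    nu N q = (chartHypersurface hF hU hN p).ν (chartAt _ p q) := by
  simp only [LocalHypersurface.ν, nu, chartHypersurface, Function.comp_apply,
    OpenPartialHomeomorph.left_inv _ hq.1]

theorem alpha_eq (hq : q ∈ chartDomain U N p) :
    alpha N q = (chartHypersurface hF hU hN p).α (chartAt _ p q) := by
  simp only [LocalHypersurface.α, alpha, chartHypersurface, Function.comp_apply,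
    OpenPartialHomeomorph.left_inv _ hq.1]

theorem chart_finrank : Module.finrank ℝ (EuclideanSpace ℝ (Fin (2 * n))) = 2 * n := by simp

/-- Derivatives along horizontal tangent vector fields in a chart. -/
theorem der_eq (hq : q ∈ chartDomain U N p) {X : M → Hor n} (hX : inner ℝ (X q) (nu N q) = 0)
    {V : Type*} [NormedAddCommGroup V] [NormedSpace ℝ V] {f : M → V}
    {g : EuclideanSpace ℝ (Fin (2 * n)) → V}
    (hg : DifferentiableAt ℝ g (chartAt (EuclideanSpace ℝ (Fin (2 * n))) p q))
    (hfg : ∀ q ∈ chartDomain U N p, f q = g (chartAt _ p q)) :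
    der F X f q = fderiv ℝ g (chartAt _ p q)
      ((chartHypersurface hF hU hN p).horLift (chartAt _ p q) (X q)) := by
  have hd := mdifferentiable_chart (I := 𝓡 (2 * n)) p
  have hx := chart_mem hF hU hN hq
  have hE := chart_finrank (n := n)
  set φ := chartAt (EuclideanSpace ℝ (Fin (2 * n))) p with hφ
  set S := chartHypersurface hF hU hN p with hS
  have hGd : fderiv ℝ S.G (φ q) = (tangentMap F q).comp
      (mfderiv (𝓡 (2 * n)) (𝓡 (2 * n)) φ.symm (φ q)) := by
    rw [← mfderiv_eq_fderiv]
    have h1 := mfderiv_comp (φ q) (g := F) ((hF.smooth _).mdifferentiableAt (by simp))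
      (hd.mdifferentiableAt_symm (φ.map_source hq.1))
    rw [φ.left_inv hq.1] at h1
    exact h1
  have hGq : S.G (φ q) = F q := congrArg F (φ.left_inv hq.1)
  -- Tangency of `X q` makes the defining condition of `lift` satisfiable, so its default value does
  -- not occur.
  have hex : ∃ v : TangentSpace (𝓡 (2 * n)) q, tangentMap F q v = frameVec (F q) (X q, 0) := by
    refine ⟨mfderiv (𝓡 (2 * n)) (𝓡 (2 * n)) φ.symm (φ q) (S.horLift (φ q) (X q)), ?_⟩
    have h1 := fderiv_horLift hE hx (X q)
    rw [← nu_eq hF hU hN hq, hX, zero_smul, sub_zero, hGq, hGd] at h1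
    exact h1
  have hlift : tangentMap F q (lift F q (X q)) = frameVec (F q) (X q, 0) := by
    rw [lift, dif_pos hex]
    exact hex.choose_spec
  -- Both vectors have the same image under the injective differential of the parametrization.
  have hu : mfderiv (𝓡 (2 * n)) (𝓡 (2 * n)) φ q (lift F q (X q)) = S.horLift (φ q) (X q) := by
    have h1 : fderiv ℝ S.G (φ q) (mfderiv (𝓡 (2 * n)) (𝓡 (2 * n)) φ q (lift F q (X q))) =
        frameVec (S.G (φ q)) (X q, 0) := by
      rw [hGd, hGq, ← hlift]
      exact congrArg (tangentMap F q) (DFunLike.congr_fun (hd.symm_comp_deriv hq.1) _)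
    have h2 := (eq_horLift_add hE hx h1).2
    rw [zero_smul, add_zero] at h2
    exact h2
  have hf : f =ᶠ[nhds q] g ∘ φ := by
    filter_upwards [chartDomain_mem_nhds hU hN hq] with y hy using hfg y hy
  rw [der, hf.mfderiv_eq, mfderiv_comp q hg.mdifferentiableAt (hd.mdifferentiableAt hq.1),
    ← hu, mfderiv_eq_fderiv]
  rfl

/-- The calculus of horizontal derivatives in a chart. -/
noncomputable abbrev chartCalculus (p : M) :=
  (chartHypersurface hF hU hN p).calculus (chart_finrank (n := n))

/-- The function `f` on the hypersurface is given in the chart by `r`. -/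
def Represents (p : M) (f : M → ℝ) (r : smoothFunctions (chartHypersurface hF hU hN p).W) :
    Prop :=
  ∀ q ∈ chartDomain U N p, f q = eval r (chartAt _ p q)

variable {hF hU hN}

theorem Represents.der_apply {f : M → ℝ} {r : smoothFunctions (chartHypersurface hF hU hN p).W}
    (hf : Represents hF hU hN p f r) (hq : q ∈ chartDomain U N p) {X : M → Hor n}
    (hX : inner ℝ (X q) (nu N q) = 0) :
    der F X f q = ∑ i, X q i * eval ((chartCalculus hF hU hN p).D i r) (chartAt _ p q) := by
  have hx := chart_mem hF hU hN hq
  rw [der_eq hF hU hN hq hX (differentiableAt_eval (chartHypersurface hF hU hN p).isOpen r hx) hf,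
    horLift_eq_sum]
  simp only [map_sum, map_smul, smul_eq_mul, eval_D hx]
  rfl

theorem represents_alpha : Represents hF hU hN p (alpha N) (chartCalculus hF hU hN p).α := by
  intro q hq
  rw [eval_α (chart_mem hF hU hN hq), alpha_eq hF hU hN hq]

theorem der_nu_apply (hq : q ∈ chartDomain U N p) {X : M → Hor n}
    (hX : inner ℝ (X q) (nu N q) = 0) (k : Fin n ⊕ Fin n) :
    der F X (nu N) q k =
      ∑ i, eval ((chartCalculus hF hU hN p).A k i) (chartAt _ p q) * X q i := by
  have hx := chart_mem hF hU hN hq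
  rw [der_eq hF hU hN hq hX (differentiableAt_ν hx) (fun q hq => nu_eq hF hU hN hq),
    horLift_eq_sum]
  simp only [map_sum, map_smul, eval_A hx]
  simp [mul_comm, horField]

omit [IsManifold (𝓡 (2 * n)) ∞ M] in
theorem inner_nu_nu (hq : q ∈ chartDomain U N p) : inner ℝ (nu N q) (nu N q) = 1 := by
  have := norm_ne_zero_iff.2 hq.2.2
  rw [nu, real_inner_self_eq_norm_sq, norm_smul, norm_inv, norm_norm]
  field_simp

omit [IsManifold (𝓡 (2 * n)) ∞ M] in
theorem inner_proj_nu (hq : q ∈ chartDomain U N p) (X : M → Hor n) :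
    inner ℝ (proj N X q) (nu N q) = 0 := by
  rw [proj, inner_sub_left, inner_smul_left, inner_nu_nu hq]
  simp

omit [TopologicalSpace M] [ChartedSpace (EuclideanSpace ℝ (Fin (2 * n))) M]
  [IsManifold (𝓡 (2 * n)) ∞ M] in
theorem inner_Jnu_nu (q : M) : inner ℝ (Jnu N q) (nu N q) = 0 := inner_J_self _

theorem inner_eq_sum (a b : Hor n) : inner ℝ a b = ∑ i, a i * b i := by
  simp only [PiLp.inner_apply, RCLike.inner_apply, conj_trivial]
  exact Finset.sum_congr rfl fun i _ => mul_comm _ _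

theorem eval_nu (hq : q ∈ chartDomain U N p) (k : Fin n ⊕ Fin n) :
    eval ((chartCalculus hF hU hN p).ν k) (chartAt _ p q) = nu N q k := by
  rw [eval_ν (chart_mem hF hU hN hq), nu_eq hF hU hN hq]

theorem eval_Jnu (hq : q ∈ chartDomain U N p) (k : Fin n ⊕ Fin n) :
    eval ((chartCalculus hF hU hN p).e k) (chartAt _ p q) = Jnu N q k := by
  rw [eval_e (chart_mem hF hU hN hq), Jnu, nu_eq hF hU hN hq]

/-- The compression of `J` to the orthogonal complement of `ν` in a chart. -/
theorem sum_K_apply (hq : q ∈ chartDomain U N p) (a : Hor n) (k : Fin n ⊕ Fin n) :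
    ∑ i, eval ((chartCalculus hF hU hN p).K k i) (chartAt _ p q) * a i =
      J a k - inner ℝ a (nu N q) * Jnu N q k + inner ℝ a (Jnu N q) * nu N q k := by
  simp only [eval_K (chart_mem hF hU hN hq), ← nu_eq hF hU hN hq]
  rw [J_apply_eq_sum a, inner_eq_sum, inner_eq_sum, Finset.sum_mul, Finset.sum_mul,
    ← Finset.sum_sub_distrib, ← Finset.sum_add_distrib]
  exact Finset.sum_congr rfl fun i _ => by rw [Jnu]; ring

theorem symForm_apply (hq : q ∈ chartDomain U N p) {X Y : M → Hor n}
    (hX : inner ℝ (X q) (nu N q) = 0) :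
    symForm F N X Y q =
      ∑ k, ∑ i, Y q k * eval ((chartCalculus hF hU hN p).B k i) (chartAt _ p q) * X q i := by
  have h1 : ∀ k, Jprime N X q k =
      ∑ i, eval ((chartCalculus hF hU hN p).K k i) (chartAt _ p q) * X q i := by
    intro k
    -- Hence `J'(X) = J(X) + ⟨X, J(ν)⟩ν`, which is what `K` does to a tangent vector.
    have hJ : J (Jnu N q) = -nu N q := J_J _
    rw [sum_K_apply hq, hX, Jprime, J_sub, J_smul, hJ]
    simp
  rw [symForm, inner_eq_sum]
  refine Finset.sum_congr rfl fun k _ => ?_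
  rw [PiLp.add_apply, PiLp.smul_apply, h1,
    der_nu_apply (hF := hF) (hU := hU) (hN := hN) hq hX, alpha_eq hF hU hN hq, smul_eq_mul,
    Finset.mul_sum, ← Finset.sum_add_distrib, Finset.sum_mul]
  refine Finset.sum_congr rfl fun i _ => ?_
  rw [HorizontalCalculus.B, Matrix.add_apply, Matrix.smul_apply, smul_eq_mul, eval_add, eval_mul,
    eval_α (chart_mem hF hU hN hq)]
  ring

end Heisenberg

/-- Evaluation of smooth functions at a point. -/
noncomputable def smoothFunctions.evalHom {E : Type*} [NormedAddCommGroup E] [NormedSpace ℝ E]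
    {W : Set E} {x : E} (hx : x ∈ W) : smoothFunctions W →+* ℝ where
  toFun f := eval f x
  map_one' := eval_one hx
  map_zero' := eval_zero x
  map_mul' f g := eval_mul f g x
  map_add' f g := eval_add f g x

/-! ### The projection orthogonal to `ν` -/

namespace HorizontalCalculus

open Matrix

variable {ι R : Type*} [Fintype ι] [DecidableEq ι] [CommRing R] [Algebra ℝ R]
  (H : HorizontalCalculus ι R)

theorem A_mul_P : H.A * H.P = H.A := by simp [P, mul_sub, mul_vecMulVec, A_ν]

theorem B_mul_P : H.B * H.P = H.B := by simp [P, mul_sub, mul_vecMulVec, B_ν]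

theorem K_mul_P : H.K * H.P = H.K := by simp [P, mul_sub, mul_vecMulVec, K_ν]

theorem P_transpose : H.Pᵀ = H.P := by simp [P, transpose_vecMulVec]

theorem sum_P_mul_D (a : ι) (f : R) : ∑ b, H.P a b * H.D b f = H.D a f := by
  have h := H.D_ν f
  simp only [P, Matrix.sub_apply, vecMulVec_apply, sub_mul, Finset.sum_sub_distrib, mul_assoc,
    ← Finset.mul_sum, h, mul_zero, sub_zero]
  simp [Matrix.one_apply]

end HorizontalCalculus

/-! ### Sums over orthonormal bases as traces -/

namespace Heisenberg

open smoothFunctions LocalHypersurface Matrix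

section FrameMatrix

variable {n : ℕ} {M : Type*} {N : M → Heis n} {q : M}

/-- The matrix whose rows are the vectors of `basisAt`. -/
noncomputable def frameMatrix (N : M → Heis n) (q : M) :
    Matrix (BasisIndex N q) (Fin n ⊕ Fin n) ℝ := of fun i a => (basisAt N q i : Hor n) a

theorem inner_basisAt (i : BasisIndex N q) : inner ℝ (basisAt N q i : Hor n) (nu N q) = 0 := by
  rw [real_inner_comm]
  exact Submodule.mem_orthogonal_singleton_iff_inner_right.1 (basisAt N q i).2

theorem frameField_apply (i : BasisIndex N q) : frameField N q i q = basisAt N q i := by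
  rw [frameField, proj, inner_basisAt, zero_smul, sub_zero]

theorem inner_frameField (i : BasisIndex N q) :
    inner ℝ (frameField N q i q) (nu N q) = 0 := by
  rw [frameField_apply, inner_basisAt]

/-- Parseval in the complement of `ν`, applied to the projections of two standard basis vectors. -/
theorem frameMatrix_transpose_mul (hν : inner ℝ (nu N q) (nu N q) = 1) (a b : Fin n ⊕ Fin n) :
    ((frameMatrix N q)ᵀ * frameMatrix N q) a b =
      (1 : Matrix (Fin n ⊕ Fin n) (Fin n ⊕ Fin n) ℝ) a b - nu N q a * nu N q b := by
  have hmem : ∀ c, EuclideanSpace.single c (1 : ℝ) - nu N q c • nu N q ∈ (ℝ ∙ nu N q)ᗮ := by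
    intro c
    rw [Submodule.mem_orthogonal_singleton_iff_inner_right, inner_sub_right, inner_smul_right, hν,
      EuclideanSpace.inner_single_right]
    simp
  have h := (basisAt N q).sum_inner_mul_inner ⟨_, hmem a⟩ ⟨_, hmem b⟩
  have h1 : ∀ c i, inner ℝ (EuclideanSpace.single c (1 : ℝ) - nu N q c • nu N q)
      (basisAt N q i : Hor n) = frameMatrix N q i c := by
    intro c i
    rw [inner_sub_left, inner_smul_left, real_inner_comm (basisAt N q i : Hor n) (nu N q),
      inner_basisAt, EuclideanSpace.inner_single_left]
    simp [frameMatrix]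
  have h2 : ∀ c i, inner ℝ (basisAt N q i : Hor n)
      (EuclideanSpace.single c (1 : ℝ) - nu N q c • nu N q) = frameMatrix N q i c := by
    intro c i
    rw [real_inner_comm, h1]
  simp only [Submodule.coe_inner, h1, h2] at h
  rw [Matrix.mul_apply]
  simp only [transpose_apply]
  rw [h, inner_sub_left, inner_sub_right, inner_sub_right, inner_smul_left, inner_smul_left,
    inner_smul_right, inner_smul_right, hν, EuclideanSpace.inner_single_left,
    EuclideanSpace.inner_single_left, EuclideanSpace.inner_single_right, Matrix.one_apply]
  simp
  ring

end FrameMatrix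

variable {n : ℕ} {M : Type*} [TopologicalSpace M]
  [ChartedSpace (EuclideanSpace ℝ (Fin (2 * n))) M] [IsManifold (𝓡 (2 * n)) ∞ M]
  {F : M → Heis n} {U : Set M} {N : M → Heis n} {hF : IsImmersedHypersurface F} {hU : IsOpen U}
  {hN : IsUnitNormalOn F U N} {p q : M}

variable (hF hU hN) in
/-- Evaluation at a point of the functions in a chart. -/
noncomputable def evalAt (hq : q ∈ chartDomain U N p) :
    smoothFunctions (chartHypersurface hF hU hN p).W →+* ℝ :=
  evalHom (chart_mem hF hU hN hq)

theorem evalAt_apply (hq : q ∈ chartDomain U N p)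
    (f : smoothFunctions (chartHypersurface hF hU hN p).W) :
    evalAt hF hU hN hq f = eval f (chartAt _ p q) := rfl

theorem frameMatrix_transpose_mul_self (hq : q ∈ chartDomain U N p) :
    (frameMatrix N q)ᵀ * frameMatrix N q =
      (chartCalculus hF hU hN p).P.map (evalAt hF hU hN hq) := by
  ext a b
  rw [frameMatrix_transpose_mul (inner_nu_nu hq), Matrix.map_apply, HorizontalCalculus.P,
    Matrix.sub_apply, map_sub, vecMulVec_apply, map_mul, evalAt_apply, evalAt_apply, evalAt_apply,
    eval_nu hq, eval_nu hq]
  congr 1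
  rw [← evalAt_apply hq, Matrix.one_apply, Matrix.one_apply]
  split_ifs <;> simp

/-- Cyclicity of the trace brings `Qᵀ` next to `Q`, which removes the chosen basis in favour of `P`.
-/
theorem trace_conj_frameMatrix (hq : q ∈ chartDomain U N p)
    (b c : Matrix (Fin n ⊕ Fin n) (Fin n ⊕ Fin n) ℝ) :
    ∑ i, ∑ j, (frameMatrix N q * b * (frameMatrix N q)ᵀ) i j *
      (frameMatrix N q * c * (frameMatrix N q)ᵀ) i j =
      (b * (chartCalculus hF hU hN p).P.map (evalAt hF hU hN hq) * cᵀ *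
        (chartCalculus hF hU hN p).P.map (evalAt hF hU hN hq)).trace := by
  rw [← frameMatrix_transpose_mul_self hq]
  generalize frameMatrix N q = Q
  have h1 : ∑ i, ∑ j, (Q * b * Qᵀ) i j * (Q * c * Qᵀ) i j =
      ((Q * b * Qᵀ) * (Q * c * Qᵀ)ᵀ).trace := by
    rw [trace]
    simp only [diag_apply, Matrix.mul_apply (M := Q * b * Qᵀ), transpose_apply]
  have h2 : (Q * b * Qᵀ) * (Q * c * Qᵀ)ᵀ = Q * (b * (Qᵀ * Q) * cᵀ * Qᵀ) := by
    simp only [transpose_mul, transpose_transpose, Matrix.mul_assoc]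
  rw [h1, h2, trace_mul_comm]
  simp only [Matrix.mul_assoc]

omit [TopologicalSpace M] [ChartedSpace (EuclideanSpace ℝ (Fin (2 * n))) M]
  [IsManifold (𝓡 (2 * n)) ∞ M] in
/-- The quadratic form of a matrix on the basis vectors. -/
theorem sum_basisAt (m : Matrix (Fin n ⊕ Fin n) (Fin n ⊕ Fin n) ℝ) (i j : BasisIndex N q) :
    ∑ k, ∑ l, (basisAt N q i : Hor n) k * m k l * (basisAt N q j : Hor n) l =
      (frameMatrix N q * m * (frameMatrix N q)ᵀ) i j := by
  rw [Matrix.mul_apply]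
  simp only [Matrix.mul_apply, Finset.sum_mul, transpose_apply]
  rw [Finset.sum_comm]
  rfl

theorem meanCurvature_eq (hq : q ∈ chartDomain U N p) :
    meanCurvature F N q = eval (chartCalculus hF hU hN p).A.trace (chartAt _ p q) := by
  have h1 : ∀ i : BasisIndex N q, secondForm F N (frameField N q i) (frameField N q i) q =
      (frameMatrix N q * (chartCalculus hF hU hN p).A.map (evalAt hF hU hN hq) *
        (frameMatrix N q)ᵀ) i i := by
    intro i
    rw [secondForm, inner_eq_sum, ← sum_basisAt]
    refine Finset.sum_congr rfl fun k _ => ?_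
    rw [der_nu_apply (hF := hF) (hU := hU) (hN := hN) hq (inner_frameField i), frameField_apply,
      Finset.sum_mul]
    refine Finset.sum_congr rfl fun l _ => ?_
    rw [Matrix.map_apply, evalAt_apply]
    ring
  rw [meanCurvature]
  simp only [h1]
  have h2 : (frameMatrix N q * (chartCalculus hF hU hN p).A.map (evalAt hF hU hN hq) *
      (frameMatrix N q)ᵀ).trace = ((chartCalculus hF hU hN p).A.map (evalAt hF hU hN hq) *
      ((frameMatrix N q)ᵀ * frameMatrix N q)).trace := by
    rw [Matrix.mul_assoc, trace_mul_comm, Matrix.mul_assoc]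
  rw [frameMatrix_transpose_mul_self (hF := hF) (hU := hU) (hN := hN) hq, ← Matrix.map_mul,
    HorizontalCalculus.A_mul_P] at h2
  refine h2.trans ?_
  rw [← evalAt_apply hq, Matrix.trace, Matrix.trace, map_sum]
  rfl

theorem gradHS_alpha_apply (hq : q ∈ chartDomain U N p) (m : Fin n ⊕ Fin n) :
    gradHS F N (alpha N) q m =
      eval ((chartCalculus hF hU hN p).D m (chartCalculus hF hU hN p).α) (chartAt _ p q) := by
  have h2 : gradHS F N (alpha N) q m =
      ∑ i, der F (frameField N q i) (alpha N) q * (frameField N q i q) m := by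
    rw [gradHS]
    simp
  rw [h2]
  have h3 := fun i : BasisIndex N q =>
    (represents_alpha (hF := hF) (hU := hU) (hN := hN)).der_apply hq (inner_frameField i)
  simp only [h3, frameField_apply, Finset.sum_mul]
  rw [Finset.sum_comm, ← HorizontalCalculus.sum_P_mul_D, eval_sum]
  refine Finset.sum_congr rfl fun a _ => ?_
  have h := congrFun (congrFun (frameMatrix_transpose_mul_self (hF := hF) (hU := hU) (hN := hN) hq)
    m) a
  rw [Matrix.map_apply, evalAt_apply, Matrix.mul_apply] at h
  rw [eval_mul, ← h, Finset.sum_mul]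
  refine Finset.sum_congr rfl fun i _ => ?_
  simp only [transpose_apply, frameMatrix, of_apply]
  ring

/-- The structure equations hold in a chart. -/
theorem chart_structureEquations (hmin : IsMinimal F) (hP2 : SatisfiesP2 F) (p : M) :
    (chartCalculus hF hU hN p).StructureEquations := by
  -- The structure equations will be differentiated, so minimality and (P2) are needed at every
  -- point of the chart piece and not only at `p`.
  have hpt : ∀ x ∈ (chartHypersurface hF hU hN p).W, ∃ q ∈ chartDomain U N p,
      chartAt (EuclideanSpace ℝ (Fin (2 * n))) p q = x := fun x hx =>
    ⟨_, ⟨OpenPartialHomeomorph.map_target _ hx.1, hx.2⟩, OpenPartialHomeomorph.right_inv _ hx.1⟩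
  refine structureEquations _ ?_ ?_
  · intro x hx
    obtain ⟨q, hq, rfl⟩ := hpt x hx
    have h1 := hmin U N hU hN q hq.2.1 (not_isCharacteristic hN hq.2.1 hq.2.2)
    rw [meanCurvature_eq (hF := hF) (hU := hU) (hN := hN) hq, Matrix.trace, eval_sum] at h1
    simp only [Matrix.diag_apply, eval_A hx] at h1
    exact h1
  · intro x hx m
    obtain ⟨q, hq, rfl⟩ := hpt x hx
    have h1 := congrArg (fun v : Hor n => v m)
      (hP2 U N hU hN q hq.2.1 (not_isCharacteristic hN hq.2.1 hq.2.2))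
    simp only [PiLp.smul_apply, smul_eq_mul] at h1
    rw [gradHS_alpha_apply (hF := hF) (hU := hU) (hN := hN) hq, eval_D_α hx] at h1
    rw [h1, der_eq hF hU hN hq (inner_Jnu_nu q) (differentiableAt_α hx)
      (fun q hq => alpha_eq hF hU hN hq), Jnu, nu_eq hF hU hN hq]

end Heisenberg

/-! ### The tangential derivative of `B` as a trace -/

namespace HorizontalCalculus

open Matrix

variable {ι R : Type*} [Fintype ι] [DecidableEq ι] [CommRing R] [Algebra ℝ R]
  (H : HorizontalCalculus ι R)

theorem P_mul_P : H.P * H.P = H.P := by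
  nth_rewrite 2 [P]
  have hν : H.P *ᵥ H.ν = 0 := by simp [P, sub_mulVec, vecMulVec_mulVec, H.norm_ν]
  simp [mul_sub, mul_vecMulVec, hν]

/-- The differentiation index may be projected as well, at no cost, because `P` acts trivially on
the derivations `D`. In this form all three indices match a sum over an orthonormal basis. -/
theorem normSqTangentialDB_eq : H.normSqTangentialDB =
    ∑ a, ∑ b, H.P a b * (H.DB a * H.P * (H.DB b)ᵀ * H.P).trace := by
  refine Finset.sum_congr rfl fun a _ => ?_
  have h1 : H.DB a = ∑ b, H.P a b • H.DB b := by
    ext j k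
    simp only [Matrix.sum_apply, Matrix.smul_apply, smul_eq_mul, DB, of_apply, sum_P_mul_D]
  have h2 : ∑ b, H.P a b * (H.DB a * H.P * (H.DB b)ᵀ * H.P).trace =
      (H.DB a * H.P * (H.DB a)ᵀ * H.P).trace := by
    have h3 : (H.DB a)ᵀ = ∑ b, H.P a b • (H.DB b)ᵀ := by
      conv_lhs => rw [h1]
      simp [transpose_sum]
    rw [h3, Matrix.mul_sum, Matrix.sum_mul, trace_sum]
    exact Finset.sum_congr rfl fun b _ => by simp
  have h4 : H.P * H.DB a * H.P * (H.P * H.DB a * H.P)ᵀ =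
      H.P * (H.DB a * H.P * (H.DB a)ᵀ * H.P) := by
    simp only [transpose_mul, P_transpose, Matrix.mul_assoc]
    rw [← Matrix.mul_assoc H.P H.P, P_mul_P]
  rw [h2, sum_sq_eq_trace, h4, trace_mul_comm, Matrix.mul_assoc, P_mul_P]

end HorizontalCalculus

/-! ### The terms of the formula in a chart -/

namespace Heisenberg

open smoothFunctions LocalHypersurface Matrix

variable {n : ℕ} {M : Type*} [TopologicalSpace M]
  [ChartedSpace (EuclideanSpace ℝ (Fin (2 * n))) M] [IsManifold (𝓡 (2 * n)) ∞ M]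
  {F : M → Heis n} {U : Set M} {N : M → Heis n} {hF : IsImmersedHypersurface F} {hU : IsOpen U}
  {hN : IsUnitNormalOn F U N} {p q : M}

theorem symForm_frameField (hq : q ∈ chartDomain U N p) (i j : BasisIndex N q) :
    symForm F N (frameField N q i) (frameField N q j) q =
      (frameMatrix N q * (chartCalculus hF hU hN p).B.map (evalAt hF hU hN hq) *
        (frameMatrix N q)ᵀ) j i := by
  rw [symForm_apply (hF := hF) (hU := hU) (hN := hN) hq (inner_frameField i), ← sum_basisAt,
    frameField_apply, frameField_apply]
  rfl

/-- On tangent vectors `π ∘ J` is `K`, so `h̃_J` has the matrix `KᵀBK`. -/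
theorem symFormJ_frameField (hq : q ∈ chartDomain U N p) (i j : BasisIndex N q) :
    symFormJ F N (frameField N q i) (frameField N q j) q =
      (frameMatrix N q * ((chartCalculus hF hU hN p).Kᵀ * (chartCalculus hF hU hN p).B *
        (chartCalculus hF hU hN p).K).map (evalAt hF hU hN hq) * (frameMatrix N q)ᵀ) j i := by
  have h1 : ∀ (i : BasisIndex N q) k, proj N (fun p => J (frameField N q i p)) q k =
      (frameMatrix N q * (chartCalculus hF hU hN p).Kᵀ.map (evalAt hF hU hN hq)) i k := by
    intro i k
    have h2 : ∑ a, eval ((chartCalculus hF hU hN p).K k a) (chartAt _ p q) *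
        (basisAt N q i : Hor n) a =
        (frameMatrix N q * (chartCalculus hF hU hN p).Kᵀ.map (evalAt hF hU hN hq)) i k := by
      rw [Matrix.mul_apply]
      refine Finset.sum_congr rfl fun a _ => ?_
      rw [mul_comm]
      rfl
    rw [← h2, sum_K_apply hq, inner_basisAt, proj, frameField_apply, inner_J_left, Jnu]
    simp
  rw [symFormJ, symForm_apply (hF := hF) (hU := hU) (hN := hN) hq (inner_proj_nu hq _)]
  simp only [h1]
  generalize frameMatrix N q = Q
  rw [Matrix.map_mul, Matrix.map_mul]
  have h3 : Q * ((chartCalculus hF hU hN p).Kᵀ.map (evalAt hF hU hN hq) *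
      (chartCalculus hF hU hN p).B.map (evalAt hF hU hN hq) *
      (chartCalculus hF hU hN p).K.map (evalAt hF hU hN hq)) * Qᵀ =
      Q * (chartCalculus hF hU hN p).Kᵀ.map (evalAt hF hU hN hq) *
      (chartCalculus hF hU hN p).B.map (evalAt hF hU hN hq) *
      (Q * (chartCalculus hF hU hN p).Kᵀ.map (evalAt hF hU hN hq))ᵀ := by
    rw [transpose_mul, transpose_map, transpose_transpose]
    simp only [Matrix.mul_assoc]
  rw [h3, Matrix.mul_apply]
  simp only [Matrix.mul_apply (N := (chartCalculus hF hU hN p).B.map (evalAt hF hU hN hq)),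
    Finset.sum_mul, transpose_apply]
  rw [Finset.sum_comm]
  rfl

theorem innerTensor_symForm (h : (chartCalculus hF hU hN p).StructureEquations)
    (hq : q ∈ chartDomain U N p) :
    innerTensor N (symForm F N) (symForm F N) q =
      eval (chartCalculus hF hU hN p).normSqB (chartAt _ p q) := by
  rw [innerTensor, Finset.sum_comm]
  simp only [symForm_frameField (hF := hF) (hU := hU) (hN := hN) hq]
  rw [trace_conj_frameMatrix (hF := hF) (hU := hU) (hN := hN) hq, ← transpose_map,
    HorizontalCalculus.B_transpose _ h, ← Matrix.map_mul, HorizontalCalculus.B_mul_P,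
    ← Matrix.map_mul, ← Matrix.map_mul, Matrix.mul_assoc, HorizontalCalculus.B_mul_P,
    HorizontalCalculus.normSqB_eq _ h, ← evalAt_apply hq, Matrix.trace, Matrix.trace, map_sum]
  rfl

theorem innerTensor_symFormJ (h : (chartCalculus hF hU hN p).StructureEquations)
    (hq : q ∈ chartDomain U N p) :
    innerTensor N (symForm F N) (symFormJ F N) q =
      eval (chartCalculus hF hU hN p).innerBJ (chartAt _ p q) := by
  rw [innerTensor, Finset.sum_comm]
  simp only [symForm_frameField (hF := hF) (hU := hU) (hN := hN) hq,
    symFormJ_frameField (hF := hF) (hU := hU) (hN := hN) hq]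
  rw [trace_conj_frameMatrix (hF := hF) (hU := hU) (hN := hN) hq, ← transpose_map,
    transpose_mul, transpose_mul, transpose_transpose, HorizontalCalculus.B_transpose _ h,
    ← Matrix.map_mul, HorizontalCalculus.B_mul_P, ← Matrix.map_mul, ← Matrix.map_mul,
    HorizontalCalculus.K_transpose]
  have h1 : (chartCalculus hF hU hN p).B * (-(chartCalculus hF hU hN p).K *
      ((chartCalculus hF hU hN p).B * (chartCalculus hF hU hN p).K)) *
      (chartCalculus hF hU hN p).P = -((chartCalculus hF hU hN p).B *
      (chartCalculus hF hU hN p).K * (chartCalculus hF hU hN p).B *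
      (chartCalculus hF hU hN p).K) := by
    simp only [Matrix.mul_assoc, Matrix.neg_mul, Matrix.mul_neg, HorizontalCalculus.K_mul_P]
  rw [h1, HorizontalCalculus.innerBJ, ← trace_neg, ← evalAt_apply hq, Matrix.trace,
    Matrix.trace, map_sum]
  rfl

/-- Differentiating `c - ⟨c, ν⟩ν` gives a multiple of `ν`, removed by the projection, and a multiple
of `⟨c, ν⟩`, which is zero at `q`. -/
theorem covS_proj_const (hF : IsImmersedHypersurface F) (hU : IsOpen U)
    (hN : IsUnitNormalOn F U N) (hq : q ∈ chartDomain U N p) {X : M → Hor n}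
    (hX : inner ℝ (X q) (nu N q) = 0) {c : Hor n} (hc : inner ℝ c (nu N q) = 0) :
    covS F N X (proj N fun _ => c) q = 0 := by
  have hx := chart_mem hF hU hN hq
  have hν := (differentiableAt_ν hx).hasFDerivAt
  have h1 := (((hasFDerivAt_const c _).inner ℝ hν).smul hν).const_sub c
  have h2 : HasFDerivAt (fun x => c - inner ℝ c
    ((chartHypersurface hF hU hN p).ν x) • (chartHypersurface hF hU hN p).ν x) _ _ := h1
  rw [covS, proj, der_eq hF hU hN hq hX h2.differentiableAt, h2.fderiv]
  · have h4 := inner_nu_nu hq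
    rw [nu_eq hF hU hN hq] at hc h4 ⊢
    simp only [_root_.neg_apply, _root_.add_apply, _root_.smul_apply,
      ContinuousLinearMap.smulRight_apply, ContinuousLinearMap.comp_apply,
      inner_neg_left, inner_add_left, inner_smul_left, hc, h4]
    simp
  · intro q' hq'
    rw [proj, nu_eq hF hU hN hq']

theorem sum_B_mul_nu (hq : q ∈ chartDomain U N p) (k : Fin n ⊕ Fin n) :
    ∑ l, eval ((chartCalculus hF hU hN p).B k l) (chartAt _ p q) * nu N q l = 0 := by
  have h := congrArg (fun r => eval r (chartAt (EuclideanSpace ℝ (Fin (2 * n))) p q))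
    (congrFun (chartCalculus hF hU hN p).B_ν k)
  simp only [mulVec, dotProduct, eval_sum, eval_mul, eval_nu hq, Pi.zero_apply, eval_zero] at h
  exact h

theorem sum_nu_mul_B (hq : q ∈ chartDomain U N p) (l : Fin n ⊕ Fin n) :
    ∑ k, nu N q k * eval ((chartCalculus hF hU hN p).B k l) (chartAt _ p q) = 0 := by
  have h := congrArg (fun r => eval r (chartAt (EuclideanSpace ℝ (Fin (2 * n))) p q))
    (congrFun (chartCalculus hF hU hN p).ν_vecMul_B l)
  simp only [vecMul, dotProduct, eval_sum, eval_mul, eval_nu hq, Pi.zero_apply, eval_zero] at h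
  exact h

/-- `B` annihilates `ν` on both sides, so the projections may be dropped at all points of the chart
domain. The function can then be differentiated with constant coefficients. -/
theorem represents_symForm_proj (c d : Hor n) :
    Represents hF hU hN p (symForm F N (proj N fun _ => c) (proj N fun _ => d))
      (∑ k, ∑ l, (d k * c l) • (chartCalculus hF hU hN p).B k l) := by
  intro q hq
  rw [symForm_apply (hF := hF) (hU := hU) (hN := hN) hq (inner_proj_nu hq _), eval_sum]
  have h1 : ∀ k, ∑ l, proj N (fun _ => d) q k *
      eval ((chartCalculus hF hU hN p).B k l) (chartAt _ p q) * proj N (fun _ => c) q l =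
      ∑ l, proj N (fun _ => d) q k *
      eval ((chartCalculus hF hU hN p).B k l) (chartAt _ p q) * c l := by
    intro k
    have h2 := sum_B_mul_nu (hF := hF) (hU := hU) (hN := hN) hq k
    have h3 : ∀ l, proj N (fun _ => d) q k *
      eval ((chartCalculus hF hU hN p).B k l) (chartAt _ p q) * proj N (fun _ => c) q l =
      proj N (fun _ => d) q k *
      eval ((chartCalculus hF hU hN p).B k l) (chartAt _ p q) * c l -
      proj N (fun _ => d) q k * inner ℝ c (nu N q) *
      (eval ((chartCalculus hF hU hN p).B k l) (chartAt _ p q) * nu N q l) := by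
      intro l
      simp only [proj, PiLp.sub_apply, PiLp.smul_apply, smul_eq_mul]
      ring
    simp only [h3, Finset.sum_sub_distrib, ← Finset.mul_sum, h2, mul_zero, sub_zero]
  simp only [h1, eval_sum, eval_smul]
  rw [Finset.sum_comm, Finset.sum_comm (f := fun k l => d k * c l *
    eval ((chartCalculus hF hU hN p).B k l) (chartAt _ p q))]
  refine Finset.sum_congr rfl fun l _ => ?_
  have h2 := sum_nu_mul_B (hF := hF) (hU := hU) (hN := hN) hq l
  have h3 : ∀ k, proj N (fun _ => d) q k *
      eval ((chartCalculus hF hU hN p).B k l) (chartAt _ p q) * c l =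
      d k * c l * eval ((chartCalculus hF hU hN p).B k l) (chartAt _ p q) -
      inner ℝ d (nu N q) * c l *
      (nu N q k * eval ((chartCalculus hF hU hN p).B k l) (chartAt _ p q)) := by
    intro k
    simp only [proj, PiLp.sub_apply, PiLp.smul_apply, smul_eq_mul]
    ring
  simp only [h3, Finset.sum_sub_distrib, ← Finset.mul_sum, h2, mul_zero, sub_zero]

/-- The extensions of the basis vectors have vanishing tangential covariant derivative at `q`, which
leaves only the derivative of the entries of `B`. -/
theorem covTensor_frameField (hq : q ∈ chartDomain U N p) (i j k : BasisIndex N q) :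
    covTensor F N (symForm F N) (frameField N q i) (frameField N q j) (frameField N q k) q =
      ∑ a, frameMatrix N q i a *
        (frameMatrix N q * ((chartCalculus hF hU hN p).DB a).map (evalAt hF hU hN hq) *
          (frameMatrix N q)ᵀ) k j := by
  have hz : ∀ j, covS F N (frameField N q i) (frameField N q j) q = 0 := fun j =>
    covS_proj_const hF hU hN hq (inner_frameField i) (inner_basisAt j)
  have h1 : symForm F N (covS F N (frameField N q i) (frameField N q j)) (frameField N q k) q
      = 0 := by
    rw [symForm_apply (hF := hF) (hU := hU) (hN := hN) hq (by rw [hz, inner_zero_left]), hz]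
    simp
  have h2 : symForm F N (frameField N q j) (covS F N (frameField N q i) (frameField N q k)) q
      = 0 := by
    rw [symForm_apply (hF := hF) (hU := hU) (hN := hN) hq (inner_frameField j), hz]
    simp
  have h3 := (represents_symForm_proj (hF := hF) (hU := hU) (hN := hN) (p := p)
    (basisAt N q j : Hor n) (basisAt N q k : Hor n)).der_apply hq (inner_frameField i)
  rw [covTensor, h1, h2, sub_zero, sub_zero]
  refine h3.trans (Finset.sum_congr rfl fun a _ => ?_)
  rw [frameField_apply, ← sum_basisAt]
  refine congrArg _ ?_
  simp only [map_sum, Derivation.map_smul, eval_sum, eval_smul]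
  refine Finset.sum_congr rfl fun b _ => Finset.sum_congr rfl fun c _ => ?_
  rw [Matrix.map_apply, evalAt_apply, HorizontalCalculus.DB, of_apply]
  ring

theorem normSqCov_eq (hq : q ∈ chartDomain U N p) :
    normSqCov F N (symForm F N) q =
      eval (chartCalculus hF hU hN p).normSqTangentialDB (chartAt _ p q) := by
  rw [HorizontalCalculus.normSqTangentialDB_eq, normSqCov]
  simp only [covTensor_frameField (hF := hF) (hU := hU) (hN := hN) hq]
  obtain ⟨T, hT⟩ : ∃ T : Fin n ⊕ Fin n → Matrix (BasisIndex N q) (BasisIndex N q) ℝ, ∀ a,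
      frameMatrix N q * ((chartCalculus hF hU hN p).DB a).map (evalAt hF hU hN hq) *
        (frameMatrix N q)ᵀ = T a := ⟨_, fun _ => rfl⟩
  have h1 : ∀ a b, ∑ j, ∑ k, T a k j * T b k j =
      eval ((chartCalculus hF hU hN p).DB a * (chartCalculus hF hU hN p).P *
        ((chartCalculus hF hU hN p).DB b)ᵀ * (chartCalculus hF hU hN p).P).trace
        (chartAt _ p q) := by
    intro a b
    simp only [← hT]
    rw [Finset.sum_comm, trace_conj_frameMatrix (hF := hF) (hU := hU) (hN := hN) hq,
      ← transpose_map, ← Matrix.map_mul, ← Matrix.map_mul, ← Matrix.map_mul,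
      ← evalAt_apply hq, Matrix.trace, Matrix.trace, map_sum]
    rfl
  have h2 : ∀ a b, ∑ i, frameMatrix N q i a * frameMatrix N q i b =
      eval ((chartCalculus hF hU hN p).P a b) (chartAt _ p q) := by
    intro a b
    have h := congrFun (congrFun
      (frameMatrix_transpose_mul_self (hF := hF) (hU := hU) (hN := hN) hq) a) b
    rw [Matrix.mul_apply] at h
    exact h
  simp only [eval_sum, eval_mul, ← h1, ← h2]
  have h3 : ∀ i j k, (∑ a, frameMatrix N q i a * T a k j) ^ 2 =
      ∑ a, ∑ b, frameMatrix N q i a * frameMatrix N q i b * (T a k j * T b k j) := by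
    intro i j k
    rw [pow_two, Finset.sum_mul_sum]
    exact Finset.sum_congr rfl fun a _ => Finset.sum_congr rfl fun b _ => by ring
  -- Only the order of summation remains: the coordinate indices `a`, `b` have to be moved outside
  -- the basis indices.
  simp only [hT, h3, Finset.sum_mul_sum]
  rw [Finset.sum_congr rfl fun i _ => Finset.sum_congr rfl fun j _ => Finset.sum_comm]
  rw [Finset.sum_congr rfl fun i _ => Finset.sum_comm]
  rw [Finset.sum_comm]
  refine Finset.sum_congr rfl fun a _ => ?_
  rw [Finset.sum_congr rfl fun i _ => Finset.sum_congr rfl fun j _ => Finset.sum_comm]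
  rw [Finset.sum_congr rfl fun i _ => Finset.sum_comm]
  rw [Finset.sum_comm]
  refine Finset.sum_congr rfl fun b _ => ?_
  refine Finset.sum_congr rfl fun i _ => ?_
  simp only [Finset.mul_sum]

theorem ell_eq (hq : q ∈ chartDomain U N p) :
    ell F N q = eval (chartCalculus hF hU hN p).ell (chartAt _ p q) := by
  rw [ell, symForm_apply (hF := hF) (hU := hU) (hN := hN) hq (inner_Jnu_nu q)]
  simp only [HorizontalCalculus.ell, dotProduct, mulVec, eval_sum, eval_mul, eval_Jnu hq,
    Finset.mul_sum, mul_assoc]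

/-- `K(J(ν)) = 0`, so `A` and `B` agree on `J(ν)`. -/
theorem norm_sq_der_Jnu_nu (hq : q ∈ chartDomain U N p) :
    ‖der F (Jnu N) (nu N) q‖ ^ 2 =
      eval (chartCalculus hF hU hN p).normSqBe (chartAt _ p q) := by
  rw [← real_inner_self_eq_norm_sq, inner_eq_sum]
  rw [HorizontalCalculus.normSqBe, ← HorizontalCalculus.A_e]
  simp only [der_nu_apply (hF := hF) (hU := hU) (hN := hN) hq (inner_Jnu_nu q), dotProduct, mulVec, eval_sum, eval_mul,
    eval_Jnu hq]

theorem der_Jnu_alpha (hq : q ∈ chartDomain U N p) :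
    der F (Jnu N) (alpha N) q = eval (chartCalculus hF hU hN p).lam (chartAt _ p q) := by
  rw [(represents_alpha (hF := hF) (hU := hU) (hN := hN)).der_apply hq (inner_Jnu_nu q)]
  simp only [HorizontalCalculus.lam, eval_sum, eval_mul, eval_Jnu hq]

/-- The representation holds on the whole chart domain, which allows it to be iterated for second
derivatives. -/
theorem Represents.derHS {f : M → ℝ} {r : smoothFunctions (chartHypersurface hF hU hN p).W}
    (hf : Represents hF hU hN p f r) (i : Fin n ⊕ Fin n) :
    Represents hF hU hN p (derHS F N i f) ((chartCalculus hF hU hN p).D i r) := by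
  intro q hq
  rw [Heisenberg.derHS, hf.der_apply hq (inner_proj_nu hq _),
    ← HorizontalCalculus.sum_P_mul_D _ i, eval_sum]
  refine Finset.sum_congr rfl fun a _ => ?_
  rw [eval_mul]
  congr 1
  have h1 : eval ((1 : Matrix (Fin n ⊕ Fin n) (Fin n ⊕ Fin n)
      (smoothFunctions (chartHypersurface hF hU hN p).W)) i a) (chartAt _ p q) =
      if a = i then 1 else 0 := by
    rw [Matrix.one_apply]
    by_cases h : i = a
    · simp [h, eval_one (chart_mem hF hU hN hq)]
    · simp [h, Ne.symm h, eval_zero]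
  rw [proj, EuclideanSpace.inner_single_left, HorizontalCalculus.P, Matrix.sub_apply, eval_sub,
    vecMulVec_apply, eval_mul, eval_nu hq, eval_nu hq, h1]
  simp

theorem modLaplacian_eq {f : M → ℝ} {r : smoothFunctions (chartHypersurface hF hU hN p).W}
    (hf : Represents hF hU hN p f r) (hq : q ∈ chartDomain U N p) :
    modLaplacian F N f q = eval (∑ i, (chartCalculus hF hU hN p).D i
      ((chartCalculus hF hU hN p).D i r) + 2 * (chartCalculus hF hU hN p).α *
      ∑ i, (chartCalculus hF hU hN p).e i * (chartCalculus hF hU hN p).D i r)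
      (chartAt _ p q) := by
  have hx := chart_mem hF hU hN hq
  rw [modLaplacian, hf.der_apply hq (inner_Jnu_nu q), eval_add, eval_mul, eval_mul, eval_sum,
    eval_sum, eval_two hx, ← represents_alpha q hq]
  simp only [eval_mul, eval_Jnu hq]
  congr 1
  exact Finset.sum_congr rfl fun i _ => (hf.derHS i).derHS i q hq

end Heisenberg

/-! ### The contracted Simons formula on the hypersurface -/

theorem theorem1p2 (n : ℕ) (M : Type*) [TopologicalSpace M]
    [ChartedSpace (EuclideanSpace ℝ (Fin (2 * n))) M] [IsManifold (𝓡 (2 * n)) ∞ M]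
    (F : M → Heisenberg.Heis n) (hF : Heisenberg.IsImmersedHypersurface F)
    (hmin : Heisenberg.IsMinimal F) (hP2 : Heisenberg.SatisfiesP2 F)
    (U : Set M) (hU : IsOpen U) (N : M → Heisenberg.Heis n)
    (hN : Heisenberg.IsUnitNormalOn F U N)
    (p : M) (hpU : p ∈ U) (hp : ¬ Heisenberg.IsCharacteristic F p) :
    (1 / 2 : ℝ) * Heisenberg.modLaplacian F N (Heisenberg.normSqSymForm F N) p =
      Heisenberg.normSqCov F N (Heisenberg.symForm F N) p
        - Heisenberg.stabilityFn F N p * Heisenberg.normSqSymForm F N p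
        + 6 * Heisenberg.alpha N p ^ 2 * Heisenberg.normSqSymForm F N p
        - 6 * Heisenberg.alpha N p ^ 2
            * ‖Heisenberg.der F (Heisenberg.Jnu N) (Heisenberg.nu N) p‖ ^ 2
        + 4 * Heisenberg.der F (Heisenberg.Jnu N) (Heisenberg.alpha N) p
            * Heisenberg.normSqSymForm F N p
        - 4 * Heisenberg.der F (Heisenberg.Jnu N) (Heisenberg.alpha N) p
            * Heisenberg.ell F N p ^ 2
        - (4 * Heisenberg.der F (Heisenberg.Jnu N) (Heisenberg.alpha N) p
              + 6 * Heisenberg.alpha N p ^ 2)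
            * Heisenberg.innerTensor N (Heisenberg.symForm F N) (Heisenberg.symFormJ F N) p := by
  have hq : p ∈ Heisenberg.chartDomain U N p :=
    ⟨mem_chart_source _ p, hpU, Heisenberg.horizontal_ne_zero hF hN hpU hp⟩
  have h := Heisenberg.chart_structureEquations (hF := hF) (hU := hU) (hN := hN) hmin hP2 p
  have hB : Heisenberg.Represents hF hU hN p (Heisenberg.normSqSymForm F N)
      (Heisenberg.chartCalculus hF hU hN p).normSqB := fun q hq =>
    Heisenberg.innerTensor_symForm h hq
  rw [Heisenberg.modLaplacian_eq hB hq, HorizontalCalculus.simons _ h, Heisenberg.stabilityFn,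
    hB p hq, Heisenberg.normSqCov_eq (hF := hF) (hU := hU) (hN := hN) hq,
    Heisenberg.norm_sq_der_Jnu_nu (hF := hF) (hU := hU) (hN := hN) hq,
    Heisenberg.der_Jnu_alpha (hF := hF) (hU := hU) (hN := hN) hq,
    Heisenberg.ell_eq (hF := hF) (hU := hU) (hN := hN) hq,
    Heisenberg.innerTensor_symFormJ h hq,
    Heisenberg.represents_alpha (hF := hF) (hU := hU) (hN := hN) p hq]
  -- Evaluation is a ring homomorphism, and the index set has `n + n` elements, so the coefficient
  -- `card + 2` of `simons` becomes the `2(n+1)` of `q`.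
  simp only [← Heisenberg.evalAt_apply hq, map_mul, map_add, map_sub, map_pow, map_ofNat,
    map_natCast, Fintype.card_sum, Fintype.card_fin, Nat.cast_add]
  ring
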